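/- **Lemma 3.1 (Cylindrical Ends).** Let $Y$ be a closed (compact, boundaryless, Hausdorff) smooth manifold with a smooth Riemannian metric $h$, and let $M=Y\times(1,\infty)_r$ carry the product metric $g_0=dr^2+h$, with Riemannian distance $d$ (equal to $\infty$ between different components) and open balls $B(x,\omega)$. Let $C_b^\infty(M)$ be the set of smooth functions $f$ on $M$ with $\sup_M|\nabla^j f|_{g_0}<\infty$ for every $j\ge 0$, where $\nabla^j f$ is the $j$-th Levi-Civita covariant derivative of $f$. Let $a:M\to\mathbb{R}$ be a function (the damping) satisfying the Network Control Condition $(L,\omega,2\beta,S)$ on $M$, that is: $L,\omega,2\beta>0$, $S\subset M$, $d(x,S)\le L$ for every $x\in M$, and $a\ge 2\beta$ on $\bigcup_{y\in S}B(y,\omega)$. Put $\Omega_{2\beta}=\{x\in M: a(x)>2\beta\}$. Then there are a single real-valued function $\psi\in C_b^\infty(M)$ with $1\le\psi\le 3$ and a constant $\rho>0$ such that $|\nabla_{g_0}\psi(x)|\ge 2\rho$ at every $x\in M$ with $a(x)<2\beta$; and, if moreover $\bigcup_{y\in S}B(y,\omega)\subset\Omega_{2\beta}$, then $$x\notin\Omega_{2\beta}\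 \Longrightarrow\ |\nabla_{g_0}\psi(x)|\ge 2\rho .$$ -/

import Mathlib

/-- The Christoffel symbols of the Levi-Civita connection of a metric `g` given in coordinates, at
the point `x`: `Γ(u, v)` is the vector with
`g(Γ(u, v), w) = ½ (∂ᵤ g(v, w) + ∂ᵥ g(u, w) - ∂_w g(u, v))` for all `w`. -/
noncomputable def christoffel {E : Type*} [NormedAddCommGroup E] [NormedSpace ℝ E]
    (g : E → E →L[ℝ] E →L[ℝ] ℝ) (x u v : E) : E :=
  let Dg : E →L[ℝ] E →L[ℝ] E →L[ℝ] ℝ := fderiv ℝ g x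
  (1 / 2 : ℝ) • (g x).inverse (Dg u v + Dg v u - (Dg.flip u).flip v)

/-- The form `((v, s), (v', s')) ↦ b(v, v') + s s'` on `F × ℝ`. -/
noncomputable def addSqForm {F : Type*} [NormedAddCommGroup F] [NormedSpace ℝ F]
    (b : F →L[ℝ] F →L[ℝ] ℝ) : (F × ℝ) →L[ℝ] (F × ℝ) →L[ℝ] ℝ :=
  b.bilinearComp (.fst ℝ F ℝ) (.fst ℝ F ℝ) +
    (ContinuousLinearMap.mul ℝ ℝ).bilinearComp (.snd ℝ F ℝ) (.snd ℝ F ℝ)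

theorem addSqForm_apply {F : Type*} [NormedAddCommGroup F] [NormedSpace ℝ F]
    (b : F →L[ℝ] F →L[ℝ] ℝ) (v w : F × ℝ) :
    addSqForm b v w = b v.1 w.1 + v.2 * w.2 := rfl

theorem addSqForm_symm {F : Type*} [NormedAddCommGroup F] [NormedSpace ℝ F]
    (b : F →L[ℝ] F →L[ℝ] ℝ) (hb : ∀ v w, b v w = b w v) (v w : F × ℝ) :
    addSqForm b v w = addSqForm b w v := by
  rw [addSqForm_apply, addSqForm_apply, hb, mul_comm]

theorem addSqForm_pos {F : Type*} [NormedAddCommGroup F] [NormedSpace ℝ F]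
    (b : F →L[ℝ] F →L[ℝ] ℝ) (hb : ∀ v, v ≠ 0 → 0 < b v v) (v : F × ℝ) (hv : v ≠ 0) :
    0 < addSqForm b v v := by
  rw [addSqForm_apply]
  by_cases h1 : v.1 = 0
  · have h2 : v.2 ≠ 0 := fun h2 => hv (Prod.ext h1 h2)
    rw [h1, map_zero, zero_add]
    exact mul_self_pos.2 h2
  · exact add_pos_of_pos_of_nonneg (hb v.1 h1) (mul_self_nonneg _)

theorem addSqForm_continuous {F : Type*} [NormedAddCommGroup F] [NormedSpace ℝ F]
    (b : F →L[ℝ] F →L[ℝ] ℝ) : Continuous fun v : F × ℝ => addSqForm b v v := by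
  simp only [addSqForm_apply]
  fun_prop

theorem addSqForm_isVonNBounded {F : Type*} [NormedAddCommGroup F] [NormedSpace ℝ F]
    (b : F →L[ℝ] F →L[ℝ] ℝ) (hb : ∀ v, v ≠ 0 → 0 < b v v)
    (h1 : Bornology.IsVonNBounded ℝ {v : F | b v v < 1}) :
    Bornology.IsVonNBounded ℝ {v : F × ℝ | addSqForm b v v < 1} := by
  have h2 : Bornology.IsVonNBounded ℝ (Metric.ball (0 : ℝ) 1) :=
    NormedSpace.isVonNBounded_ball ℝ ℝ 1
  rw [NormedSpace.isVonNBounded_iff] at h1 h2 ⊢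
  refine (h1.prod h2).subset ?_
  intro v hv
  rw [Set.mem_ofPred_eq, addSqForm_apply] at hv
  have h0 : 0 ≤ b v.1 v.1 := by
    by_cases hz : v.1 = 0
    · rw [hz, map_zero]
    · exact (hb v.1 hz).le
  refine ⟨?_, ?_⟩
  · rw [Set.mem_ofPred_eq]
    nlinarith [mul_self_nonneg v.2]
  · rw [mem_ball_zero_iff, Real.norm_eq_abs, ← sq_lt_one_iff_abs_lt_one]
    nlinarith

open Bundle Manifold
open scoped ContDiff ENNReal Topology

noncomputable section

/-! ### Riemannian manifolds (boundaryless, finite-dimensional): gradient, `C_b^∞`, network control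

The Riemannian metric is Mathlib's `RiemannianBundle` structure on the tangent bundle, the distance
is Mathlib's `riemannianEDist` (infimum of lengths of `C¹` paths, `⊤` between distinct components). -/

section Riemannian

variable {E : Type*} [NormedAddCommGroup E] [NormedSpace ℝ E]
  {H : Type*} [TopologicalSpace H] (I : ModelWithCorners ℝ E H)
  {M : Type*} [TopologicalSpace M] [ChartedSpace H M] [IsManifold I ∞ M]
  [RiemannianBundle (fun x : M => TangentSpace I x)]

/-- The Riemannian gradient: the tangent vector `∇f(x)` with `⟪∇f(x), X⟫ = df(x) X` for all `X`. -/
def riemGradient [FiniteDimensional ℝ E] (f : M → ℝ) (x : M) : TangentSpace I x :=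
  haveI : FiniteDimensional ℝ (TangentSpace I x) := inferInstanceAs (FiniteDimensional ℝ E)
  haveI : CompleteSpace (TangentSpace I x) := FiniteDimensional.complete ℝ _
  (InnerProductSpace.toDual ℝ (TangentSpace I x)).symm (mfderiv I 𝓘(ℝ, ℝ) f x)

set_option synthInstance.maxHeartbeats 400000 in
/-- The coordinate expression `x ↦ (g_{ij}(x))` of the metric in the chart of `M` around `c`, as a
bilinear form on the model space. -/
def metricInChart (c : M) (x : E) : E →L[ℝ] E →L[ℝ] ℝ :=
  let q : M := (extChartAt I c).symm x
  let A : E →L[ℝ] TangentSpace I q := mfderiv 𝓘(ℝ, E) I (extChartAt I c).symm x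
  (innerSL ℝ (E := TangentSpace I q)).bilinearComp A A

/-- The coordinate expression, in the chart around `c`, of the iterated Levi-Civita covariant
derivative `∇ʲf`, a covariant `j`-tensor: `∇⁰f = f` and
`(∇ʲ⁺¹f)(v₀, v₁, …, v_j) = ∂_{v₀} ((∇ʲf)(v₁, …, v_j)) - ∑ᵢ (∇ʲf)(v₁, …, Γ(v₀, vᵢ), …, v_j)`. -/
def iteratedCovDeriv (f : M → ℝ) (c : M) : (j : ℕ) → E → (Fin j → E) → ℝ
  | 0 => fun x _ => f ((extChartAt I c).symm x)
  | j + 1 => fun x v =>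
      fderiv ℝ (fun y => iteratedCovDeriv f c j y (Fin.tail v)) x (v 0)
        - ∑ i : Fin j, iteratedCovDeriv f c j x
            (Function.update (Fin.tail v) i (christoffel (metricInChart I c) x (v 0) (Fin.tail v i)))

/-- `f ∈ C_b^∞(M)`: `f` is smooth and, for each `j`, the tensor norm of the covariant derivative
`∇ʲf` is bounded uniformly on `M`. At each point `p` the tensor `∇ʲf(p)` may be computed in any
chart containing `p`: its norm does not depend on the chart. -/
def IsCbInfty (f : M → ℝ) : Prop :=
  ContMDiff I 𝓘(ℝ, ℝ) ∞ f ∧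
    ∀ j : ℕ, ∃ C : ℝ, ∀ p : M, ∃ c : M, p ∈ (chartAt H c).source ∧
      ∀ v : Fin j → E,
        |iteratedCovDeriv I f c j (extChartAt I c p) v| ≤
          C * ∏ i, √(metricInChart I c (extChartAt I c p) (v i) (v i))

/-- The open ball `B(y, w)` for the Riemannian distance. -/
def riemBall (y : M) (w : ℝ) : Set M := {x | riemannianEDist I y x < ENNReal.ofReal w}

/-- The function `a` satisfies the network control condition with constants `L, w, κ > 0` and set of
points `S`: every point is at distance at most `L` from `S`, and `a ≥ κ` on the union of the balls
of radius `w` centred at the points of `S`. -/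
structure NetworkControl (a : M → ℝ) (L w κ : ℝ) (S : Set M) : Prop where
  L_pos : 0 < L
  w_pos : 0 < w
  kappa_pos : 0 < κ
  dist_le : ∀ x : M, (⨅ y ∈ S, riemannianEDist I x y) ≤ ENNReal.ofReal L
  le_on_balls : ∀ x ∈ (⋃ y ∈ S, riemBall I y w), κ ≤ a x

end Riemannian

/-- The region `Ω_υ = {a > υ}`. -/
def superlevel {M : Type*} (a : M → ℝ) (υ : ℝ) : Set M := {x | υ < a x}

/-! ### The cylindrical end `Y × (1, ∞)` with the metric `dr² + h` -/

/-- The half-line `(1, ∞)` as an open submanifold of `ℝ`. -/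
def rayOne : TopologicalSpace.Opens ℝ := ⟨Set.Ioi 1, isOpen_Ioi⟩

section Cylinder

variable {n : ℕ} {Y : Type*} [TopologicalSpace Y] [ChartedSpace (EuclideanSpace ℝ (Fin n)) Y]
  [IsManifold (𝓡 n) ∞ Y]

/-- The cylindrical end over the Riemannian manifold `(Y, h)`: as a manifold, it is the product
`Y × (1, ∞)`. The metric `h` is recorded in the type to determine the product metric. -/
def CylindricalEnd
    (_h : ContMDiffRiemannianMetric (𝓡 n) ∞ (EuclideanSpace ℝ (Fin n))
      (fun y : Y => TangentSpace (𝓡 n) y)) : Type _ :=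
  Y × rayOne

variable (h : ContMDiffRiemannianMetric (𝓡 n) ∞ (EuclideanSpace ℝ (Fin n))
      (fun y : Y => TangentSpace (𝓡 n) y))

instance : TopologicalSpace (CylindricalEnd h) := inferInstanceAs (TopologicalSpace (Y × rayOne))

instance : ChartedSpace (ModelProd (EuclideanSpace ℝ (Fin n)) ℝ) (CylindricalEnd h) :=
  inferInstanceAs (ChartedSpace (ModelProd (EuclideanSpace ℝ (Fin n)) ℝ) (Y × rayOne))

instance : IsManifold ((𝓡 n).prod 𝓘(ℝ, ℝ)) ∞ (CylindricalEnd h) :=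
  inferInstanceAs (IsManifold ((𝓡 n).prod 𝓘(ℝ, ℝ)) ∞ (Y × rayOne))

/-- The product Riemannian metric `g₀ = dr² + h` on the cylindrical end, with
`T_{(y, r)}(Y × (1, ∞)) = T_y Y × ℝ`. -/
def cylinderMetric :
    RiemannianMetric (fun p : CylindricalEnd h => TangentSpace ((𝓡 n).prod 𝓘(ℝ, ℝ)) p) where
  inner p := addSqForm (F := EuclideanSpace ℝ (Fin n)) (h.inner p.1)
  symm p := addSqForm_symm (F := EuclideanSpace ℝ (Fin n)) _ (h.symm p.1)
  pos p := addSqForm_pos (F := EuclideanSpace ℝ (Fin n)) _ (h.pos p.1)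
  continuousAt _ := (addSqForm_continuous (F := EuclideanSpace ℝ (Fin n)) _).continuousAt
  isVonNBounded p :=
    addSqForm_isVonNBounded (F := EuclideanSpace ℝ (Fin n)) _ (h.pos p.1) (h.isVonNBounded p.1)

instance :
    RiemannianBundle (fun p : CylindricalEnd h => TangentSpace ((𝓡 n).prod 𝓘(ℝ, ℝ)) p) :=
  ⟨cylinderMetric h⟩

end Cylinder

end

/-!
Add a sine wave in `r` of period `4 R`, with `R > L`, to a small function on `Y` with finitely many
critical points. The sum has finitely many critical points in each slab of length `4 R`, and every
connected component of the middle of a slab meets `S` since `S` comes within distance `L` of every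
point. A diffeomorphism supported in the middle of the slab therefore moves the critical points
into a given neighbourhood of `S`. After translation to the first slab, take that neighbourhood to
be a union of members of a fixed finite cover by sets of diameter less than `ω`: it stays inside the
balls `B(y, ω)`, `y ∈ S`, and only finitely many such unions occur. Up to translation the resulting
function is thus locally one of finitely many functions, each of them considered on a compact set,
which gives uniform bounds on its covariant derivatives and a positive lower bound on its gradient
away from the balls.
-/

open Set Function Metric Filter

local notation "𝔼" n:max => EuclideanSpace ℝ (Fin n)
local notation "𝓒" n:max => ModelWithCorners.prod (𝓡 n) 𝓘(ℝ, ℝ)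

section MovingPoints

section FlatSpace

variable {E : Type*} [NormedAddCommGroup E] [NormedSpace ℝ E]

theorem exists_diffeomorph_add_of_lipschitzWith [CompleteSpace E] {g : E → E} {K : NNReal}
    (hg : ContDiff ℝ ∞ g) (hK : LipschitzWith K g) (hK1 : K < 1) :
    ∃ θ : E ≃ₘ^∞⟮𝓘(ℝ, E), 𝓘(ℝ, E)⟯ E, ∀ x, θ x = x + g x := by
  have hlin : ApproximatesLinearOn (fun x => x + g x)
      (ContinuousLinearEquiv.refl ℝ E : E →L[ℝ] E) univ K := fun x _ y _ => by
    simpa [add_sub_add_comm, dist_eq_norm] using hK.dist_le_mul x y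
  have hsmooth : ContDiff ℝ ∞ fun x => x + g x := contDiff_id.add hg
  have hinv : Subsingleton E ∨
      K < ‖((ContinuousLinearEquiv.refl ℝ E).symm : E →L[ℝ] E)‖₊⁻¹ := by
    refine (subsingleton_or_nontrivial E).imp_right fun (_ : Nontrivial E) => ?_
    rwa [ContinuousLinearEquiv.refl_symm, ContinuousLinearEquiv.coe_refl,
      ContinuousLinearMap.nnnorm_id, inv_one]
  let θ : E ≃ₜ E := hlin.toHomeomorph _ hinv
  have hderiv (x : E) : IsUnit (1 + fderiv ℝ g x) := by
    have hnorm : ‖-fderiv ℝ g x‖ < 1 := by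
      rw [norm_neg]
      exact (norm_fderiv_le_of_lipschitz ℝ hK).trans_lt hK1
    rw [← sub_neg_eq_add]
    exact isUnit_one_sub_of_norm_lt_one hnorm
  choose A hA using hderiv
  have hθ (x : E) : HasFDerivAt θ (ContinuousLinearEquiv.ofUnit (A x) : E →L[ℝ] E) x := by
    have hadd := (hasFDerivAt_id x).add (hg.differentiable (by simp) x).hasFDerivAt
    exact hadd.congr_fderiv (hA x).symm
  exact ⟨⟨θ.toEquiv, hsmooth.contMDiff, (θ.contDiff_symm hθ hsmooth).contMDiff⟩, fun _ => rfl⟩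

theorem exists_diffeomorph_eqOn_compl_closedBall [FiniteDimensional ℝ E] (z : E) {r : ℝ}
    (hr : 0 < r) :
    ∃ s > 0, ∀ x ∈ ball z s, ∀ y ∈ ball z s, ∃ θ : E ≃ₘ^∞⟮𝓘(ℝ, E), 𝓘(ℝ, E)⟯ E,
      EqOn θ id (closedBall z r)ᶜ ∧ θ x = y := by
  let χ : ContDiffBump z := ⟨r / 2, r, half_pos hr, half_lt_self hr⟩
  obtain ⟨K, hK⟩ := χ.contDiff.lipschitzWith_of_hasCompactSupport (n := ∞) χ.hasCompactSupport
    (by simp)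
  refine ⟨min (r / 2) (2 * (K + 1))⁻¹, by positivity, fun x hx y hy => ?_⟩
  have hyx : ‖y - x‖ * (K + 1) < 1 := by
    have h2 : dist y x < 2 * (2 * (K + 1) : ℝ)⁻¹ := by
      have := dist_triangle_right y x z
      have hx' := (mem_ball.1 hx).trans_le (min_le_right _ _)
      have hy' := (mem_ball.1 hy).trans_le (min_le_right _ _)
      linarith
    rw [mul_inv, mul_inv_cancel_left₀ two_ne_zero, dist_eq_norm] at h2
    exact (lt_div_iff₀ (by positivity)).1 (by rwa [one_div])
  have hlip : LipschitzWith (K * ‖y - x‖₊) fun p => χ p • (y - x) :=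
    LipschitzWith.of_dist_le_mul fun p q => by
      rw [dist_eq_norm, ← sub_smul, norm_smul, ← dist_eq_norm, NNReal.coe_mul, mul_right_comm]
      exact mul_le_mul_of_nonneg_right (hK.dist_le_mul p q) (norm_nonneg _)
  obtain ⟨θ, hθ⟩ := exists_diffeomorph_add_of_lipschitzWith
    (show ContDiff ℝ ∞ fun p => χ p • (y - x) from χ.contDiff.smul contDiff_const) hlip (by
      rw [← NNReal.coe_lt_coe, NNReal.coe_mul, coe_nnnorm, NNReal.coe_one]
      nlinarith [norm_nonneg (y - x)])
  refine ⟨θ, fun p hp => ?_, ?_⟩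
  · rw [hθ, χ.zero_of_le_dist (not_le.1 fun h => hp h).le, zero_smul, add_zero, id]
  · rw [hθ, χ.one_of_mem_closedBall, one_smul, add_sub_cancel]
    exact (mem_ball.1 hx).le.trans (min_le_left _ _)

end FlatSpace

theorem connectedComponentIn_diff_singleton_inter_nonempty {X : Type*} [TopologicalSpace X]
    [T1Space X] [LocallyConnectedSpace X] {N V : Set X} {p q : X} (hN : IsOpen N)
    (hV : IsOpen V) (hpV : p ∈ V) (hq : q ∈ N) (hqp : q ≠ p)
    (hqV : (connectedComponentIn N q ∩ V).Nonempty) :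
    (connectedComponentIn (N \ {p}) q ∩ V).Nonempty := by
  set C := connectedComponentIn (N \ {p}) q
  have hqC : q ∈ C := mem_connectedComponentIn ⟨hq, hqp⟩
  by_contra! hdisj
  refine hqV.ne_empty (subset_empty_iff.1 ((inter_subset_inter_left V ?_).trans hdisj.subset))
  refine isPreconnected_connectedComponentIn.subset_of_closure_inter_subset
    (hN.sdiff isClosed_singleton).connectedComponentIn
    ⟨q, mem_connectedComponentIn hq, hqC⟩ ?_
  rintro z ⟨hzC, hz⟩
  have hzp : z ≠ p := by
    rintro rfl
    obtain ⟨y, hyV, hyC⟩ := mem_closure_iff.1 hzC V hV hpV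
    exact hdisj.subset (mem_inter hyC hyV)
  have hzN : z ∈ N \ {p} := ⟨connectedComponentIn_subset _ _ hz, hzp⟩
  have hconn : IsPreconnected (insert z C) :=
    isPreconnected_connectedComponentIn.subset_closure (subset_insert z C)
      (insert_subset hzC subset_closure)
  exact hconn.subset_connectedComponentIn (mem_insert_of_mem z hqC)
    (insert_subset hzN (connectedComponentIn_subset _ _)) (mem_insert z C)

section Chart

variable {E : Type*} [NormedAddCommGroup E] [NormedSpace ℝ E]
  {H : Type*} [TopologicalSpace H] (I : ModelWithCorners ℝ E H)
  {X : Type*} [TopologicalSpace X] [ChartedSpace H X]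

open Classical in
/-- The self-map of a manifold that is given by `θ` in the chart around `c` and by the identity off
the domain of this chart. -/
noncomputable def chartConj (c : X) (θ : E → E) (x : X) : X :=
  if x ∈ (extChartAt I c).source then (extChartAt I c).symm (θ (extChartAt I c x)) else x

variable {I} {c : X} {θ θ₁ θ₂ : E → E} {K : Set E}

theorem chartConj_of_mem {x : X} (hx : x ∈ (extChartAt I c).source) :
    chartConj I c θ x = (extChartAt I c).symm (θ (extChartAt I c x)) :=
  if_pos hx

theorem chartConj_of_notMem {x : X} (hx : x ∉ (extChartAt I c).source) :
    chartConj I c θ x = x :=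
  if_neg hx

theorem chartConj_of_notMem_image (hθ : EqOn θ id Kᶜ) {x : X}
    (hx : x ∉ (extChartAt I c).symm '' K) : chartConj I c θ x = x := by
  by_cases hc : x ∈ (extChartAt I c).source
  · have hxK : extChartAt I c x ∉ K := fun hK => hx ⟨_, hK, (extChartAt I c).left_inv hc⟩
    rw [chartConj_of_mem hc, hθ hxK, id, (extChartAt I c).left_inv hc]
  · exact chartConj_of_notMem hc

theorem leftInverse_chartConj (hθ : LeftInverse θ₁ θ₂)
    (hmaps : MapsTo θ₂ (extChartAt I c).target (extChartAt I c).target) :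
    LeftInverse (chartConj I c θ₁) (chartConj I c θ₂) := fun x => by
  by_cases hc : x ∈ (extChartAt I c).source
  · have ht := hmaps ((extChartAt I c).map_source hc)
    rw [chartConj_of_mem hc, chartConj_of_mem ((extChartAt I c).map_target ht),
      (extChartAt I c).right_inv ht, hθ, (extChartAt I c).left_inv hc]
  · rw [chartConj_of_notMem (θ := θ₂) hc, chartConj_of_notMem hc]

theorem contMDiff_chartConj [T2Space X] [IsManifold I ∞ X] (hsmooth : ContDiff ℝ ∞ θ)
    (hK : IsCompact K) (hKc : K ⊆ (extChartAt I c).target) (hθ : EqOn θ id Kᶜ)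
    (hmaps : MapsTo θ (extChartAt I c).target (extChartAt I c).target) :
    ContMDiff I I ∞ (chartConj I c θ) := by
  have hKX : IsCompact ((extChartAt I c).symm '' K) :=
    hK.image_of_continuousOn ((continuousOn_extChartAt_symm c).mono hKc)
  refine contMDiff_of_contMDiffOn_union_of_isOpen (s := (extChartAt I c).source)
    (t := ((extChartAt I c).symm '' K)ᶜ) ?_ ?_ ?_ (isOpen_extChartAt_source c)
    hKX.isClosed.isOpen_compl
  · refine ContMDiffOn.congr ?_ fun x hx => chartConj_of_mem hx
    refine (contMDiffOn_extChartAt_symm c).comp (hsmooth.contMDiff.comp_contMDiffOn ?_)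
      fun x hx => hmaps ((extChartAt I c).map_source hx)
    rw [extChartAt_source]
    exact contMDiffOn_extChartAt
  · exact contMDiffOn_id.congr fun x hx => chartConj_of_notMem_image hθ hx
  · rw [union_comm, ← compl_subset_iff_union, compl_compl]
    exact (image_mono hKc).trans (extChartAt I c).mapsTo_symm.image_subset

theorem mapsTo_of_eqOn_id_compl {α : Type*} {f : α → α} (hf : Injective f) {s t : Set α}
    (h : EqOn f id sᶜ) (hst : s ⊆ t) : MapsTo f t t := fun x hx => by
  by_contra hn
  have hfix : f (f x) = f x := h fun hs => hn (hst hs)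
  exact hn ((hf hfix).symm ▸ hx)

theorem exists_diffeomorph_of_chart [T2Space X] [IsManifold I ∞ X]
    (θ : E ≃ₘ^∞⟮𝓘(ℝ, E), 𝓘(ℝ, E)⟯ E) (hK : IsCompact K)
    (hKc : K ⊆ (extChartAt I c).target) (hθ : EqOn θ id Kᶜ) :
    ∃ Φ : X ≃ₘ^∞⟮I, I⟯ X, EqOn Φ id ((extChartAt I c).symm '' K)ᶜ ∧
      ∀ x ∈ (extChartAt I c).source, Φ x = (extChartAt I c).symm (θ (extChartAt I c x)) := by
  have hθ' : EqOn θ.symm id Kᶜ := fun p hp =>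
    (θ.symm_apply_eq).2 (hθ hp).symm
  have hmaps := mapsTo_of_eqOn_id_compl θ.injective hθ hKc
  have hmaps' := mapsTo_of_eqOn_id_compl θ.symm.injective hθ' hKc
  exact ⟨{  toFun := chartConj I c θ
            invFun := chartConj I c θ.symm
            left_inv := leftInverse_chartConj θ.left_inv hmaps
            right_inv := leftInverse_chartConj θ.right_inv hmaps'
            contMDiff_toFun := contMDiff_chartConj θ.contDiff hK hKc hθ hmaps
            contMDiff_invFun := contMDiff_chartConj θ.symm.contDiff hK hKc hθ' hmaps' },
    fun x hx => chartConj_of_notMem_image hθ hx, fun x hx => chartConj_of_mem hx⟩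

variable [FiniteDimensional ℝ E] [T2Space X] [IsManifold I ∞ X] [I.Boundaryless]

theorem exists_nhds_forall_exists_diffeomorph (c : X) {W : Set X} (hW : W ∈ 𝓝 c) :
    ∃ B ∈ 𝓝 c, ∀ x ∈ B, ∀ y ∈ B, ∃ Φ : X ≃ₘ^∞⟮I, I⟯ X, EqOn Φ id Wᶜ ∧ Φ x = y := by
  have hWc : (extChartAt I c).target ∩ (extChartAt I c).symm ⁻¹' W ∈ 𝓝 (extChartAt I c c) :=
    inter_mem (extChartAt_target_mem_nhds c)
      ((continuousAt_extChartAt_symm c).preimage_mem_nhds (by rwa [extChartAt_to_inv]))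
  obtain ⟨r, hr, hball⟩ := nhds_basis_closedBall.mem_iff.1 hWc
  obtain ⟨s, hs, hmove⟩ := exists_diffeomorph_eqOn_compl_closedBall (extChartAt I c c) hr
  refine ⟨(extChartAt I c).source ∩ extChartAt I c ⁻¹' ball (extChartAt I c c) s,
    inter_mem (extChartAt_source_mem_nhds c)
      ((continuousAt_extChartAt c).preimage_mem_nhds (ball_mem_nhds _ hs)), ?_⟩
  rintro x ⟨hxc, hx⟩ y ⟨hyc, hy⟩
  obtain ⟨θ, hθ, hθx⟩ := hmove _ hx _ hy
  obtain ⟨Φ, hΦ, hΦθ⟩ := exists_diffeomorph_of_chart θ (isCompact_closedBall _ r)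
    (fun p hp => (hball hp).1) hθ
  refine ⟨Φ, hΦ.mono (compl_subset_compl.2 (image_subset_iff.2 fun p hp => (hball hp).2)), ?_⟩
  rw [hΦθ x hxc, hθx, (extChartAt I c).left_inv hyc]

theorem exists_diffeomorph_apply_eq_of_isPreconnected {N : Set X} (hN : IsOpen N)
    (hNc : IsPreconnected N) {p q : X} (hp : p ∈ N) (hq : q ∈ N) :
    ∃ Φ : X ≃ₘ^∞⟮I, I⟯ X, EqOn Φ id Nᶜ ∧ Φ p = q := by
  let A : Set X := {x | ∃ Φ : X ≃ₘ^∞⟮I, I⟯ X, EqOn Φ id Nᶜ ∧ Φ x = q}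
  have hlocal (z : X) (hz : z ∈ N) : ∃ B ∈ 𝓝 z, ∀ x ∈ B, ∀ y ∈ B, y ∈ A → x ∈ A := by
    obtain ⟨B, hB, hmove⟩ := exists_nhds_forall_exists_diffeomorph (I := I) z (hN.mem_nhds hz)
    refine ⟨B, hB, fun x hx y hy ⟨Φ, hΦ, hΦy⟩ => ?_⟩
    obtain ⟨Φ', hΦ', rfl⟩ := hmove x hx y hy
    exact ⟨Φ'.trans Φ, fun z hz => (congrArg Φ (hΦ' hz)).trans (hΦ hz), hΦy⟩
  have hopen : IsOpen (A ∩ N) := isOpen_iff_mem_nhds.2 fun z ⟨hzA, hz⟩ => by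
    obtain ⟨B, hB, hBA⟩ := hlocal z hz
    exact inter_mem (mem_of_superset hB fun x hx => hBA x hx z (mem_of_mem_nhds hB) hzA)
      (hN.mem_nhds hz)
  have hclosed : closure (A ∩ N) ∩ N ⊆ A ∩ N := fun z ⟨hzA, hz⟩ => by
    obtain ⟨B, hB, hBA⟩ := hlocal z hz
    obtain ⟨y, hyB, hyA, -⟩ := mem_closure_iff_nhds.1 hzA B hB
    exact ⟨hBA z (mem_of_mem_nhds hB) y hyB hyA, hz⟩
  have hqA : q ∈ A := ⟨Diffeomorph.refl I X ∞, fun _ _ => rfl, rfl⟩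
  exact (hNc.subset_of_closure_inter_subset hopen ⟨q, hq, hqA, hq⟩ hclosed hp).1

theorem exists_diffeomorph_mapsTo_of_finite [LocallyConnectedSpace X] {F : Set X}
    (hF : F.Finite) : ∀ {N U : Set X}, IsOpen N → IsOpen U → F ⊆ N →
      (∀ p ∈ F, (connectedComponentIn N p ∩ U).Nonempty) →
      ∃ Φ : X ≃ₘ^∞⟮I, I⟯ X, EqOn Φ id Nᶜ ∧ MapsTo Φ F U := by
  induction F, hF using Set.Finite.induction_on with
  | empty => exact fun _ _ _ _ => ⟨Diffeomorph.refl I X ∞, fun _ _ => rfl, mapsTo_empty _ _⟩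
  | @insert p F hpF _ ih =>
    intro N U hN hU hFN hmeet
    have hp : p ∈ N := hFN (mem_insert p F)
    obtain ⟨u, huN, huU⟩ := hmeet p (mem_insert p F)
    obtain ⟨Φ₂, hΦ₂, rfl⟩ := exists_diffeomorph_apply_eq_of_isPreconnected (I := I)
      hN.connectedComponentIn isPreconnected_connectedComponentIn (mem_connectedComponentIn hp) huN
    have hU' : IsOpen (Φ₂ ⁻¹' U) := hU.preimage Φ₂.continuous
    have hmeet' (q : X) (hq : q ∈ F) : (connectedComponentIn N q ∩ Φ₂ ⁻¹' U).Nonempty := by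
      obtain ⟨z, hzq, hzU⟩ := hmeet q (mem_insert_of_mem p hq)
      by_cases hz : z ∈ connectedComponentIn N p
      · refine ⟨p, ?_, huU⟩
        rw [connectedComponentIn_eq hzq, ← connectedComponentIn_eq hz]
        exact mem_connectedComponentIn hp
      · exact ⟨z, hzq, by rwa [mem_preimage, hΦ₂ hz]⟩
    have hne (q : X) (hq : q ∈ F) : q ≠ p := ne_of_mem_of_not_mem hq hpF
    obtain ⟨Φ₁, hΦ₁, hF₁⟩ := ih (N := N \ {p}) (hN.sdiff isClosed_singleton) hU'
      (fun q hq => ⟨hFN (mem_insert_of_mem p hq), hne q hq⟩) fun q hq =>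
        connectedComponentIn_diff_singleton_inter_nonempty hN hU' huU
          (hFN (mem_insert_of_mem p hq)) (hne q hq) (hmeet' q hq)
    refine ⟨Φ₁.trans Φ₂, fun z hz => ?_, ?_⟩
    · have hz₁ : Φ₁ z = z := hΦ₁ fun h => hz h.1
      have hz₂ : Φ₂ z = z := hΦ₂ fun h => hz (connectedComponentIn_subset _ _ h)
      exact (congrArg Φ₂ hz₁).trans hz₂
    · rintro q (rfl | hq)
      · have hq₁ : Φ₁ q = q := hΦ₁ fun h => h.2 rfl
        exact (congrArg (Φ₂ · ∈ U) hq₁).mpr huU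
      · exact hF₁ hq

end Chart

end MovingPoints

section CriticalPoints

open MeasureTheory

theorem ae_forall_injOn_nhds_of_contDiffAt {V : Type*} [NormedAddCommGroup V] [NormedSpace ℝ V]
    [FiniteDimensional ℝ V] [MeasurableSpace V] [BorelSpace V] (μ : Measure V)
    [μ.IsAddHaarMeasure] {G : V → V} {O : Set V} (hG : ∀ b ∈ O, ContDiffAt ℝ 1 G b) :
    ∀ᵐ a ∂μ, ∀ b ∈ O, G b = a → ∃ B ∈ 𝓝 b, InjOn G B := by
  have hnull : μ (G '' {b ∈ O | (fderiv ℝ G b).det = 0}) = 0 :=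
    addHaar_image_eq_zero_of_det_fderivWithin_eq_zero μ (f' := fderiv ℝ G)
      (fun b hb => ((hG b hb.1).differentiableAt one_ne_zero).hasFDerivAt.hasFDerivWithinAt)
      (fun b hb => hb.2)
  filter_upwards [compl_mem_ae_iff.2 hnull] with a ha b hb hba
  have hdet : (fderiv ℝ G b).det ≠ 0 := fun h => ha ⟨b, ⟨hb, h⟩, hba⟩
  have hstrict : HasStrictFDerivAt G
      ((fderiv ℝ G b).toContinuousLinearEquivOfDetNeZero hdet : V →L[ℝ] V) b := by
    rw [ContinuousLinearMap.coe_toContinuousLinearEquivOfDetNeZero]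
    exact (hG b hb).hasStrictFDerivAt one_ne_zero
  refine ⟨_, hstrict.eventually_left_inverse, LeftInvOn.injOn fun x hx => hx⟩

section Conormal

variable {E V : Type*} [NormedAddCommGroup E] [NormedSpace ℝ E]
  [NormedAddCommGroup V] [NormedSpace ℝ V]

/-- A parametrization of the linear forms `ℓ` on `V` for which `ℓ ∘ e` has a critical point, where
`e : E → V` has a linear left inverse `P` and `s` is a linear right inverse of `P`. Every form
`l - l ∘ De(x) ∘ P` is critical at `x`; the parameter `l` also encodes `x`, which is read off
`l ∘ s` through the identification `J` of `E` with its dual. -/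
noncomputable def conormalMap (J : E ≃L[ℝ] (E →L[ℝ] ℝ)) (P : V →L[ℝ] E) (s : E →L[ℝ] V) (e : E → V)
    (l : V →L[ℝ] ℝ) : V →L[ℝ] ℝ :=
  l - l ∘L fderiv ℝ e (J.symm (l ∘L s)) ∘L P

variable {J : E ≃L[ℝ] (E →L[ℝ] ℝ)} {P : V →L[ℝ] E} {s : E →L[ℝ] V} {e : E → V} {ℓ : V →L[ℝ] ℝ}

theorem conormalParam_comp_section (hs : P ∘L s = .id ℝ E) (x : E) :
    (ℓ + (J x - ℓ ∘L s) ∘L P) ∘L s = J x := by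
  rw [ContinuousLinearMap.add_comp, ContinuousLinearMap.comp_assoc, hs,
    ContinuousLinearMap.comp_id, add_sub_cancel]

theorem conormalMap_param {x : E} (hs : P ∘L s = .id ℝ E) (he : P ∘L fderiv ℝ e x = .id ℝ E)
    (hx : ℓ ∘L fderiv ℝ e x = 0) :
    conormalMap J P s e (ℓ + (J x - ℓ ∘L s) ∘L P) = ℓ := by
  rw [conormalMap, conormalParam_comp_section hs, J.symm_apply_apply,
    ← ContinuousLinearMap.comp_assoc, ContinuousLinearMap.add_comp, hx,
    ContinuousLinearMap.comp_assoc, he, ContinuousLinearMap.comp_id, zero_add, add_sub_cancel_right]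

theorem contDiffAt_conormalMap {l : V →L[ℝ] ℝ} (he : ContDiffAt ℝ 2 e (J.symm (l ∘L s))) :
    ContDiffAt ℝ 1 (conormalMap J P s e) l := by
  have hbase : ContDiff ℝ 1 fun l' : V →L[ℝ] ℝ => J.symm (l' ∘L s) :=
    J.symm.contDiff.comp (by fun_prop)
  have hderiv : ContDiffAt ℝ 1 (fun l' : V →L[ℝ] ℝ => fderiv ℝ e (J.symm (l' ∘L s))) l :=
    (he.fderiv_right (by norm_num)).comp l hbase.contDiffAt
  exact contDiffAt_id.sub (contDiffAt_id.clm_comp (hderiv.clm_comp contDiffAt_const))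

variable [FiniteDimensional ℝ E] [FiniteDimensional ℝ V]

theorem nonempty_continuousLinearEquiv_dual : Nonempty (E ≃L[ℝ] (E →L[ℝ] ℝ)) :=
  ⟨.ofFinrankEq <| Subspace.dual_finrank_eq.symm.trans
    (LinearMap.toContinuousLinearMap : (E →ₗ[ℝ] ℝ) ≃ₗ[ℝ] (E →L[ℝ] ℝ)).finrank_eq⟩

theorem ae_isolated_critical [MeasurableSpace (V →L[ℝ] ℝ)] [BorelSpace (V →L[ℝ] ℝ)]
    (μ : Measure (V →L[ℝ] ℝ)) [μ.IsAddHaarMeasure] {W : Set E} (hW : IsOpen W)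
    (he : ∀ x ∈ W, ContDiffAt ℝ 2 e x) (hP : ∀ x ∈ W, P (e x) = x) :
    ∀ᵐ ℓ ∂μ, ∀ x ∈ W, ∀ᶠ x' in 𝓝[≠] x, ℓ ∘L fderiv ℝ e x' ≠ 0 := by
  obtain rfl | ⟨x₀, hx₀⟩ := W.eq_empty_or_nonempty
  · simp
  obtain ⟨J⟩ := nonempty_continuousLinearEquiv_dual (E := E)
  have hPe : ∀ x ∈ W, P ∘L fderiv ℝ e x = .id ℝ E := fun x hx => by
    have hid : P ∘ e =ᶠ[𝓝 x] id := (hW.eventually_mem hx).mono hP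
    rw [← P.fderiv, ← fderiv_comp x P.differentiableAt ((he x hx).differentiableAt two_ne_zero),
      hid.fderiv_eq, fderiv_id]
  set s := fderiv ℝ e x₀
  have hs : P ∘L s = .id ℝ E := hPe x₀ hx₀
  set G := conormalMap J P s e
  have hG : ∀ l ∈ {l : V →L[ℝ] ℝ | J.symm (l ∘L s) ∈ W}, ContDiffAt ℝ 1 G l := fun l hl =>
    contDiffAt_conormalMap (he _ hl)
  filter_upwards [ae_forall_injOn_nhds_of_contDiffAt μ hG] with ℓ hℓ x hx
  let param (x' : E) : V →L[ℝ] ℝ := ℓ + (J x' - ℓ ∘L s) ∘L P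
  have hparam : Continuous param := by fun_prop
  have hbase (x' : E) : J.symm (param x' ∘L s) = x' := by
    rw [conormalParam_comp_section hs, J.symm_apply_apply]
  have hmem : param x ∈ {l : V →L[ℝ] ℝ | J.symm (l ∘L s) ∈ W} := by
    rwa [mem_ofPred_eq, hbase]
  have hcrit : ∀ x' ∈ W, ℓ ∘L fderiv ℝ e x' = 0 → G (param x') = ℓ := fun x' hx' =>
    conormalMap_param hs (hPe x' hx')
  have hWx : ∀ᶠ x' in 𝓝[≠] x, x' ∈ W := (hW.eventually_mem hx).filter_mono nhdsWithin_le_nhds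
  rcases eq_or_ne (G (param x)) ℓ with heq | hne
  · obtain ⟨B, hB, hinj⟩ := hℓ _ hmem heq
    filter_upwards [hWx, (hparam.continuousAt.eventually hB).filter_mono nhdsWithin_le_nhds,
      self_mem_nhdsWithin] with x' hx' hx'B hx'x hzero
    have hparam_eq := hinj hx'B (mem_of_mem_nhds hB) ((hcrit x' hx' hzero).trans heq.symm)
    exact hx'x (by rw [mem_singleton_iff, ← hbase x', hparam_eq, hbase])
  · have hnear : ∀ᶠ x' in 𝓝 x, G (param x') ≠ ℓ :=
      ((hG _ hmem).continuousAt.comp (f := param) hparam.continuousAt).eventually_ne hne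
    filter_upwards [hWx, hnear.filter_mono nhdsWithin_le_nhds] with x' hx' hx'ne hzero
    exact hx'ne (hcrit x' hx' hzero)

end Conormal

section Manifold

variable {E : Type*} [NormedAddCommGroup E] [NormedSpace ℝ E]
  {H : Type*} [TopologicalSpace H] {I : ModelWithCorners ℝ E H}
  {X : Type*} [TopologicalSpace X] [ChartedSpace H X]

theorem finite_of_forall_eventually_notMem {X : Type*} [TopologicalSpace X] [CompactSpace X]
    {K : Set X} (hK : ∀ x, ∀ᶠ x' in 𝓝[≠] x, x' ∉ K) : K.Finite := by
  by_contra hinf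
  obtain ⟨x, hx⟩ := Set.Infinite.exists_accPt_principal hinf
  exact accPt_iff_frequently_nhdsNE.1 hx (hK x)

variable [I.Boundaryless] [IsManifold I ∞ X]

theorem contDiffAt_comp_extChartAt_symm {V : Type*} [NormedAddCommGroup V] [NormedSpace ℝ V]
    {e : X → V} (he : ContMDiff I 𝓘(ℝ, V) ∞ e) {c : X} {x : E} (hx : x ∈ (extChartAt I c).target) :
    ContDiffAt ℝ ∞ (e ∘ (extChartAt I c).symm) x :=
  ((he _).comp x ((contMDiffOn_extChartAt_symm c).contMDiffAt
    ((isOpen_extChartAt_target c).mem_nhds hx))).contDiffAt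

theorem comp_fderiv_eq_zero_of_mfderiv_eq_zero {V : Type*} [NormedAddCommGroup V] [NormedSpace ℝ V]
    {e : X → V} (he : ContMDiff I 𝓘(ℝ, V) ∞ e) (ℓ : V →L[ℝ] ℝ) {c y : X}
    (hy : y ∈ (extChartAt I c).source) (hcrit : mfderiv I 𝓘(ℝ, ℝ) (ℓ ∘ e) y = 0) :
    ℓ ∘L fderiv ℝ (e ∘ (extChartAt I c).symm) (extChartAt I c y) = 0 := by
  have hxt := (extChartAt I c).map_source hy
  have hsymm : MDifferentiableAt 𝓘(ℝ, E) I (extChartAt I c).symm (extChartAt I c y) :=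
    ((contMDiffOn_extChartAt_symm (n := ∞) c).contMDiffAt
      ((isOpen_extChartAt_target c).mem_nhds hxt)).mdifferentiableAt (by simp)
  rw [← (extChartAt I c).left_inv hy] at hcrit
  have hdiff := (contDiffAt_comp_extChartAt_symm he hxt).differentiableAt (by simp)
  rw [← ℓ.fderiv (x := (e ∘ (extChartAt I c).symm) (extChartAt I c y)),
    ← fderiv_comp _ ℓ.differentiableAt hdiff, ← comp_assoc, ← mfderiv_eq_fderiv,
    mfderiv_comp _ ((ℓ.contMDiff.comp he).mdifferentiable (by simp) _) hsymm, hcrit]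
  exact ContinuousLinearMap.zero_comp _

variable [FiniteDimensional ℝ E] [T2Space X] [CompactSpace X]

theorem exists_contMDiff_finite_critical :
    ∃ m : X → ℝ, ContMDiff I 𝓘(ℝ, ℝ) ∞ m ∧ {x | mfderiv I 𝓘(ℝ, ℝ) m x = 0}.Finite := by
  obtain ⟨ι, f, -⟩ := SmoothBumpCovering.exists_isSubordinate I (s := (univ : Set X))
    (U := fun _ => univ) isClosed_univ fun _ _ => univ_mem
  have : Fintype ι := f.fintype
  let φ (i : ι) : PartialEquiv X E := extChartAt I (f.c i)
  let e (y : X) (i : ι) : E := f i y • φ i y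
  have he : ContMDiff I 𝓘(ℝ, ι → E) ∞ e := contMDiff_pi_space.2 fun i =>
    (f i).contMDiff_smul contMDiffOn_extChartAt
  let W (i : ι) : Set E := interior {x ∈ (φ i).target | f i ((φ i).symm x) = 1}
  have hW (i : ι) : W i ⊆ {x ∈ (φ i).target | f i ((φ i).symm x) = 1} := interior_subset
  have hsmooth : ∀ i, ∀ x ∈ W i, ContDiffAt ℝ 2 (e ∘ (φ i).symm) x := fun i x hx =>
    (contDiffAt_comp_extChartAt_symm he (hW i hx).1).of_le (by norm_cast)
  have hleft : ∀ i, ∀ x ∈ W i, ContinuousLinearMap.proj (R := ℝ) i (e ((φ i).symm x)) = x :=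
    fun i x hx => by
      obtain ⟨hxt, hx1⟩ := hW i hx
      simp only [ContinuousLinearMap.proj_apply, e, hx1, one_smul, (φ i).right_inv hxt]
  borelize ((ι → E) →L[ℝ] ℝ)
  obtain ⟨ℓ, hℓ⟩ := (eventually_all.2 fun i => ae_isolated_critical Measure.addHaar
    isOpen_interior (hsmooth i) (hleft i)).exists
  refine ⟨ℓ ∘ e, ℓ.contMDiff.comp he, finite_of_forall_eventually_notMem fun y => ?_⟩
  set i := f.ind y (mem_univ y)
  have hy : y ∈ (φ i).source := f.mem_extChartAt_ind_source y (mem_univ y)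
  have hyW : φ i y ∈ W i := by
    have hone : ∀ᶠ y' in 𝓝 ((φ i).symm (φ i y)), f i y' = 1 := by
      rw [(φ i).left_inv hy]
      exact f.eventuallyEq_one y (mem_univ y)
    exact mem_interior_iff_mem_nhds.2 <| ((isOpen_extChartAt_target (f.c i)).eventually_mem
      ((φ i).map_source hy)).and ((continuousAt_extChartAt_symm' hy).eventually hone)
  have hsource : ∀ᶠ y' in 𝓝[≠] y, y' ∈ (φ i).source :=
    ((isOpen_extChartAt_source (f.c i)).eventually_mem hy).filter_mono nhdsWithin_le_nhds
  have hφ : Tendsto (φ i) (𝓝[≠] y) (𝓝[≠] (φ i y)) :=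
    tendsto_nhdsWithin_iff.2 ⟨(continuousAt_extChartAt' hy).continuousWithinAt, by
      filter_upwards [hsource, self_mem_nhdsWithin] with y' hy' hne heq
      exact hne ((φ i).injOn hy' hy heq)⟩
  filter_upwards [hφ.eventually (hℓ i _ hyW), hsource] with y' hne hy' hcrit
  exact hne (comp_fderiv_eq_zero_of_mfderiv_eq_zero he ℓ hy' hcrit)

variable (I X) in
theorem exists_contMDiff_abs_le_finite_critical {ε : ℝ} (hε : 0 < ε) :
    ∃ b : X → ℝ, ContMDiff I 𝓘(ℝ, ℝ) ∞ b ∧ (∀ x, |b x| ≤ ε) ∧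
      {x | mfderiv I 𝓘(ℝ, ℝ) b x = 0}.Finite := by
  obtain ⟨m, hm, hfin⟩ := exists_contMDiff_finite_critical (I := I) (X := X)
  obtain ⟨C, hC⟩ := isCompact_univ.exists_bound_of_continuousOn hm.continuous.continuousOn
  have hscale : 0 < ε / (|C| + 1) := by positivity
  refine ⟨fun x => ε / (|C| + 1) * m x, contMDiff_const.mul hm, fun x => ?_,
    hfin.subset fun x hx => ?_⟩
  · have hmx : |m x| ≤ |C| + 1 := ((hC x (mem_univ x)).trans (le_abs_self C)).trans (by simp)
    rw [abs_mul, abs_of_pos hscale]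
    calc ε / (|C| + 1) * |m x| ≤ ε / (|C| + 1) * (|C| + 1) := by gcongr
      _ = ε := div_mul_cancel₀ _ (by positivity)
  · have hmul := (hm.mdifferentiable (by simp) x).hasMFDerivAt.const_smul (ε / (|C| + 1))
    exact (smul_eq_zero.1 (hmul.mfderiv.symm.trans hx)).resolve_left hscale.ne'

end Manifold

end CriticalPoints

section Coordinates

variable {E : Type*} [NormedAddCommGroup E] [NormedSpace ℝ E]
  {g : E → E →L[ℝ] E →L[ℝ] ℝ} {f : E → ℝ} {O K : Set E}

/-- The iterated Levi-Civita covariant derivatives `∇ʲf` of a function on a normed space, for a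
metric `g` given in coordinates; `iteratedCovDeriv` is the case of the metric of a manifold read in
a chart. -/
noncomputable def coordCovDeriv (g : E → E →L[ℝ] E →L[ℝ] ℝ) (f : E → ℝ) :
    (j : ℕ) → E → (Fin j → E) → ℝ
  | 0 => fun x _ => f x
  | j + 1 => fun x v =>
      fderiv ℝ (fun y => coordCovDeriv g f j y (Fin.tail v)) x (v 0)
        - ∑ i : Fin j, coordCovDeriv g f j x
            (update (Fin.tail v) i (christoffel g x (v 0) (Fin.tail v i)))

theorem iteratedCovDeriv_eq_coordCovDeriv {H : Type*} [TopologicalSpace H]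
    (I : ModelWithCorners ℝ E H) {M : Type*} [TopologicalSpace M] [ChartedSpace H M]
    [RiemannianBundle (fun x : M => TangentSpace I x)] (f : M → ℝ) (c : M) (j : ℕ) :
    iteratedCovDeriv I f c j = coordCovDeriv (metricInChart I c) (f ∘ (extChartAt I c).symm) j := by
  induction j with
  | zero => rfl
  | succ j ih =>
    funext x v
    simp only [iteratedCovDeriv, coordCovDeriv, ih]

set_option maxSynthPendingDepth 3 in
theorem christoffel_smul (g : E → E →L[ℝ] E →L[ℝ] ℝ) (x u v : E) (a b : ℝ) :
    christoffel g x (a • u) (b • v) = (a * b) • christoffel g x u v := by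
  have hdual : fderiv ℝ g x (a • u) (b • v) + fderiv ℝ g x (b • v) (a • u)
        - ((fderiv ℝ g x).flip (a • u)).flip (b • v) =
      (a * b) • (fderiv ℝ g x u v + fderiv ℝ g x v u - ((fderiv ℝ g x).flip u).flip v) := by
    refine ContinuousLinearMap.ext fun w => ?_
    simp only [map_smul, sub_apply, add_apply, ContinuousLinearMap.flip_apply, smul_apply,
      smul_eq_mul]
    ring
  simp only [christoffel]
  rw [hdual, map_smul, smul_comm]

theorem update_smul_christoffel {j : ℕ} (g : E → E →L[ℝ] E →L[ℝ] ℝ) (x u : E) (a : ℝ)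
    (c : Fin j → ℝ) (v : Fin j → E) (i : Fin j) :
    update (fun k => c k • v k) i (christoffel g x (a • u) (c i • v i)) =
      fun k => update c i (a * c i) k • update v i (christoffel g x u (v i)) k := by
  funext k
  rcases eq_or_ne k i with rfl | hk
  · simp only [update_self, christoffel_smul]
  · simp only [update_of_ne hk]

theorem coordCovDeriv_smul (g : E → E →L[ℝ] E →L[ℝ] ℝ) (f : E → ℝ) (j : ℕ) (x : E)
    (c : Fin j → ℝ) (v : Fin j → E) :
    coordCovDeriv g f j x (fun i => c i • v i) = (∏ i, c i) * coordCovDeriv g f j x v := by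
  induction j generalizing x with
  | zero => simp [coordCovDeriv]
  | succ j ih =>
    have htail : Fin.tail (fun i => c i • v i) = fun i => Fin.tail c i • Fin.tail v i := rfl
    have hprod : ∏ i, c i = c 0 * ∏ i, Fin.tail c i := Fin.prod_univ_succ c
    simp only [coordCovDeriv]
    rw [htail, mul_sub, Finset.mul_sum]
    congr 1
    · simp only [ih, map_smul]
      change c 0 • fderiv ℝ ((∏ i, Fin.tail c i) • fun y => coordCovDeriv g f j y (Fin.tail v)) x
        (v 0) = _
      rw [fderiv_const_smul_field, Pi.smul_apply, smul_apply, smul_smul,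
        smul_eq_mul, hprod]
    · refine Finset.sum_congr rfl fun i _ => ?_
      rw [update_smul_christoffel, ih, Finset.prod_update_of_mem (Finset.mem_univ i), hprod,
        ← Finset.mul_prod_erase Finset.univ (Fin.tail c) (Finset.mem_univ i),
        Finset.sdiff_singleton_eq_erase]
      ring

set_option maxSynthPendingDepth 3 in
theorem eventually_christoffel_eq_translate {g' : E → E →L[ℝ] E →L[ℝ] ℝ} {x τ : E}
    (hg : ∀ᶠ y in 𝓝 x, g' y = g (y + τ)) :
    ∀ᶠ y in 𝓝 x, christoffel g' y = christoffel g (y + τ) := by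
  filter_upwards [hg.eventually_nhds] with y hy
  have hfderiv : fderiv ℝ g' y = fderiv ℝ g (y + τ) := by
    rw [EventuallyEq.fderiv_eq (f := fun z => g (z + τ)) hy, fderiv_comp_add_right]
  funext u v
  simp only [christoffel, hy.self_of_nhds, hfderiv]

theorem eventually_coordCovDeriv_eq_translate {g' : E → E →L[ℝ] E →L[ℝ] ℝ} {f' : E → ℝ} {x τ : E}
    (hg : ∀ᶠ y in 𝓝 x, g' y = g (y + τ)) (hf : ∀ᶠ y in 𝓝 x, f' y = f (y + τ)) (j : ℕ) :
    ∀ᶠ y in 𝓝 x, coordCovDeriv g' f' j y = coordCovDeriv g f j (y + τ) := by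
  induction j with
  | zero => filter_upwards [hf] with y hy using funext fun _ => hy
  | succ j ih =>
    filter_upwards [ih.eventually_nhds, eventually_christoffel_eq_translate hg] with y hy hΓ
    funext v
    have hfderiv : fderiv ℝ (fun z => coordCovDeriv g' f' j z (Fin.tail v)) y =
        fderiv ℝ (fun z => coordCovDeriv g f j z (Fin.tail v)) (y + τ) := by
      rw [← fderiv_comp_add_right]
      exact EventuallyEq.fderiv_eq (hy.mono fun z hz => congrFun hz _)
    simp only [coordCovDeriv, hy.self_of_nhds, hfderiv, hΓ]

set_option maxSynthPendingDepth 3 in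
theorem contDiffOn_clm_flip {P F₁ F₂ F₃ : Type*} [NormedAddCommGroup P] [NormedSpace ℝ P]
    [NormedAddCommGroup F₁] [NormedSpace ℝ F₁] [NormedAddCommGroup F₂] [NormedSpace ℝ F₂]
    [NormedAddCommGroup F₃] [NormedSpace ℝ F₃] {A : P → F₁ →L[ℝ] F₂ →L[ℝ] F₃} {s : Set P}
    {n : WithTop ℕ∞} (hA : ContDiffOn ℝ n A s) : ContDiffOn ℝ n (fun p => (A p).flip) s :=
  (ContinuousLinearMap.flipₗᵢ ℝ F₁ F₂ F₃).contDiff.comp_contDiffOn hA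

theorem sq_norm_mul_le_of_forall_sphere {b : E →L[ℝ] E →L[ℝ] ℝ} {m : ℝ}
    (hb : ∀ u ∈ sphere (0 : E) 1, m ≤ b u u) (v : E) : m * ‖v‖ ^ 2 ≤ b v v := by
  rcases eq_or_ne v 0 with rfl | hv
  · simp
  have hu : m ≤ ‖v‖⁻¹ * (‖v‖⁻¹ * b v v) := by
    simpa using hb (‖v‖⁻¹ • v) (by simp [norm_smul, hv])
  have hv' : ‖v‖ ≠ 0 := norm_ne_zero_iff.2 hv
  calc m * ‖v‖ ^ 2 ≤ ‖v‖⁻¹ * (‖v‖⁻¹ * b v v) * ‖v‖ ^ 2 := by gcongr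
    _ = b v v := by field_simp [hv']

theorem contDiff_fin_tail (j : ℕ) : ContDiff ℝ ∞ (Fin.tail : (Fin (j + 1) → E) → Fin j → E) :=
  contDiff_pi.2 fun k => contDiff_apply ℝ E k.succ

variable [FiniteDimensional ℝ E]

set_option maxSynthPendingDepth 3 in
theorem contDiffOn_christoffel (hO : IsOpen O) (hg : ContDiffOn ℝ ∞ g O)
    (hinv : ∀ x ∈ O, (g x).IsInvertible) {P : Type*} [NormedAddCommGroup P] [NormedSpace ℝ P]
    {s : Set P} {x u v : P → E} (hx : ContDiffOn ℝ ∞ x s) (hu : ContDiffOn ℝ ∞ u s)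
    (hv : ContDiffOn ℝ ∞ v s) (hxs : MapsTo x s O) :
    ContDiffOn ℝ ∞ (fun p => christoffel g (x p) (u p) (v p)) s := by
  have hD : ContDiffOn ℝ ∞ (fun p => fderiv ℝ g (x p)) s :=
    (hg.fderiv_of_isOpen hO (by simp)).comp hx hxs
  have hI : ContDiffOn ℝ ∞ (fun p => (g (x p)).inverse) s := by
    intro p hp
    exact (hinv _ (hxs hp)).contDiffAt_map_inverse.comp_contDiffWithinAt p (hg.comp hx hxs p hp)
  refine ContDiffOn.const_smul _ (hI.clm_apply ?_)
  exact (((hD.clm_apply hu).clm_apply hv).add ((hD.clm_apply hv).clm_apply hu)).sub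
    ((contDiffOn_clm_flip ((contDiffOn_clm_flip hD).clm_apply hu)).clm_apply hv)

theorem contDiffOn_update_christoffel (hO : IsOpen O) (hg : ContDiffOn ℝ ∞ g O)
    (hinv : ∀ x ∈ O, (g x).IsInvertible) {j : ℕ} (i : Fin j) :
    ContDiffOn ℝ ∞ (fun p : E × (Fin (j + 1) → E) =>
      update (Fin.tail p.2) i (christoffel g p.1 (p.2 0) (Fin.tail p.2 i))) (O ×ˢ univ) := by
  have happ : ∀ k, ContDiffOn ℝ ∞ (fun p : E × (Fin (j + 1) → E) => p.2 k) (O ×ˢ univ) :=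
    fun k => ((contDiff_apply ℝ E k).comp contDiff_snd).contDiffOn
  refine contDiffOn_pi.2 fun k => ?_
  rcases eq_or_ne k i with rfl | hk
  · simp only [update_self]
    exact contDiffOn_christoffel hO hg hinv contDiffOn_fst (happ 0) (happ _) fun p hp => hp.1
  · simp only [update_of_ne hk]
    exact happ k.succ

theorem contDiffOn_coordCovDeriv (hO : IsOpen O) (hg : ContDiffOn ℝ ∞ g O)
    (hinv : ∀ x ∈ O, (g x).IsInvertible) (hf : ContDiffOn ℝ ∞ f O) (j : ℕ) :
    ContDiffOn ℝ ∞ (fun p : E × (Fin j → E) => coordCovDeriv g f j p.1 p.2) (O ×ˢ univ) := by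
  induction j with
  | zero => exact hf.comp contDiffOn_fst fun p hp => hp.1
  | succ j ih =>
    refine ContDiffOn.sub (fun p hp => ContDiffAt.contDiffWithinAt ?_)
      (ContDiffOn.sum fun i _ => ?_)
    · have hbase : ContDiffAt ℝ ∞ (fun q : E × (Fin j → E) => coordCovDeriv g f j q.1 q.2)
          (p.1, Fin.tail p.2) :=
        ih.contDiffAt ((hO.prod isOpen_univ).mem_nhds ⟨hp.1, mem_univ _⟩)
      have hjoint : ContDiffAt ℝ ∞ (uncurry fun (q : E × (Fin (j + 1) → E)) y =>
          coordCovDeriv g f j y (Fin.tail q.2)) (p, p.1) :=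
        hbase.comp (p, p.1)
          (f := fun q : (E × (Fin (j + 1) → E)) × E => (q.2, Fin.tail q.1.2))
          (contDiffAt_snd.prodMk ((contDiff_fin_tail j).comp
            (contDiff_snd.comp contDiff_fst)).contDiffAt)
      exact (hjoint.fderiv contDiffAt_fst (m := ∞) (by simp)).clm_apply
        ((contDiff_apply ℝ E 0).comp contDiff_snd).contDiffAt
    · exact ih.comp (contDiffOn_fst.prodMk (contDiffOn_update_christoffel hO hg hinv i))
        fun p hp => ⟨hp.1, mem_univ _⟩

theorem isInvertible_of_pos {b : E →L[ℝ] E →L[ℝ] ℝ} (hb : ∀ v, v ≠ 0 → 0 < b v v) :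
    b.IsInvertible := by
  have hinj : Injective b := (injective_iff_map_eq_zero _).2 fun v hv => by
    by_contra h
    simpa [hv] using hb v h
  have hfin : Module.finrank ℝ E = Module.finrank ℝ (E →L[ℝ] ℝ) :=
    (nonempty_continuousLinearEquiv_dual (E := E)).some.toLinearEquiv.finrank_eq
  exact ⟨(LinearEquiv.ofInjectiveOfFinrankEq b.toLinearMap hinj hfin).toContinuousLinearEquiv,
    by ext; rfl⟩

theorem exists_norm_le_mul_sqrt (hK : IsCompact K) (hg : ContinuousOn g K)
    (hpos : ∀ x ∈ K, ∀ v, v ≠ 0 → 0 < g x v v) :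
    ∃ C : ℝ, 0 ≤ C ∧ ∀ x ∈ K, ∀ v, ‖v‖ ≤ C * √(g x v v) := by
  have hcont : ContinuousOn (fun p : E × E => g p.1 p.2 p.2) (K ×ˢ sphere (0 : E) 1) :=
    ((hg.comp continuousOn_fst fun p hp => hp.1).clm_apply continuousOn_snd).clm_apply
      continuousOn_snd
  obtain ⟨m, hm, hmg⟩ := (hK.prod (isCompact_sphere 0 1)).exists_forall_le' hcont (a := 0)
    fun p hp => hpos _ hp.1 _ (ne_zero_of_mem_unit_sphere ⟨p.2, hp.2⟩)
  refine ⟨(√m)⁻¹, by positivity, fun x hx v => ?_⟩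
  rw [← Real.sqrt_inv, ← Real.sqrt_mul (by positivity), inv_mul_eq_div]
  refine Real.le_sqrt_of_sq_le ((le_div_iff₀' hm).2 ?_)
  exact sq_norm_mul_le_of_forall_sphere (fun u hu => hmg (x, u) ⟨hx, hu⟩) v

theorem exists_coordCovDeriv_le (hO : IsOpen O) (hg : ContDiffOn ℝ ∞ g O)
    (hpos : ∀ x ∈ O, ∀ v, v ≠ 0 → 0 < g x v v) (hf : ContDiffOn ℝ ∞ f O) (hK : IsCompact K)
    (hKO : K ⊆ O) (j : ℕ) :
    ∃ C : ℝ, ∀ x ∈ K, ∀ v : Fin j → E,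
      |coordCovDeriv g f j x v| ≤ C * ∏ i, √(g x (v i) (v i)) := by
  obtain ⟨C₁, hC₁, hnorm⟩ := exists_norm_le_mul_sqrt hK (hg.continuousOn.mono hKO)
    fun x hx => hpos x (hKO hx)
  have hcont := (contDiffOn_coordCovDeriv hO hg (fun x hx => isInvertible_of_pos (hpos x hx)) hf
    j).continuousOn
  obtain ⟨C₂, hC₂⟩ := (hK.prod (isCompact_univ_pi fun _ : Fin j =>
      isCompact_closedBall (0 : E) 1)).exists_bound_of_continuousOn
    (hcont.mono (prod_mono hKO (subset_univ _)))
  refine ⟨C₂ * C₁ ^ j, fun x hx v => ?_⟩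
  have hunit : |coordCovDeriv g f j x fun i => ‖v i‖⁻¹ • v i| ≤ C₂ :=
    hC₂ (x, _) ⟨hx, fun i _ => inv_norm_smul_mem_unitClosedBall (v i)⟩
  have hv : (fun i => ‖v i‖ • ‖v i‖⁻¹ • v i) = v := funext fun i => by
    rcases eq_or_ne (v i) 0 with h | h
    · simp [h]
    · rw [smul_inv_smul₀ (norm_ne_zero_iff.2 h)]
  calc |coordCovDeriv g f j x v|
      = (∏ i, ‖v i‖) * |coordCovDeriv g f j x fun i => ‖v i‖⁻¹ • v i| := by
        conv_lhs => rw [← hv, coordCovDeriv_smul]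
        rw [abs_mul, abs_of_nonneg (Finset.prod_nonneg fun i _ => norm_nonneg (v i))]
    _ ≤ (∏ i, C₁ * √(g x (v i) (v i))) * C₂ := by
        have := (abs_nonneg _).trans hunit
        gcongr with i
        exact hnorm x hx (v i)
    _ = C₂ * C₁ ^ j * ∏ i, √(g x (v i) (v i)) := by
        rw [Finset.prod_mul_distrib, Finset.prod_const, Finset.card_univ, Fintype.card_fin]
        ring

end Coordinates

section TangentForms

variable {E : Type*} [NormedAddCommGroup E] [NormedSpace ℝ E]
  {H : Type*} [TopologicalSpace H] (I : ModelWithCorners ℝ E H) [I.Boundaryless]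
  {M : Type*} [TopologicalSpace M] [ChartedSpace H M]

/-- The coordinate expression, in the chart around `c`, of a field `b` of bilinear forms on the
tangent spaces. -/
noncomputable def formInChart (b : ∀ q : M, TangentSpace I q →L[ℝ] TangentSpace I q →L[ℝ] ℝ)
    (c : M) (x : E) : E →L[ℝ] E →L[ℝ] ℝ :=
  let q : M := (extChartAt I c).symm x
  let A : E →L[ℝ] E := mfderiv 𝓘(ℝ, E) I (extChartAt I c).symm x
  ContinuousLinearMap.bilinearComp (E := E) (F := E) (b q) A A

variable [IsManifold I ∞ M]

theorem formInChart_extChartAt_apply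
    (b : ∀ q : M, TangentSpace I q →L[ℝ] TangentSpace I q →L[ℝ] ℝ) {c q : M}
    (hq : q ∈ (chartAt H c).source) (v w : E) :
    formInChart I b c (extChartAt I c q) v w =
      b q ((trivializationAt E (TangentSpace I) c).symm q v)
        ((trivializationAt E (TangentSpace I) c).symm q w) := by
  have hM : IsManifold I 1 M := .of_le (n := ∞) (by simp)
  have hsymmL := TangentBundle.symmL_trivializationAt (I := I) hq
  rw [I.range_eq_univ, mfderivWithin_univ] at hsymmL
  have hsymm (v : E) : (trivializationAt E (TangentSpace I) c).symm q v =
      mfderiv 𝓘(ℝ, E) I (extChartAt I c).symm (extChartAt I c q) v :=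
    (Trivialization.symmL_apply (R := ℝ) _ (by simpa using hq) v).symm.trans
      (congrArg (fun A : E →L[ℝ] E => A v) hsymmL)
  have hleft : (extChartAt I c).symm (extChartAt I c q) = q :=
    (extChartAt I c).left_inv (by rwa [extChartAt_source])
  have hbase (q' : M) (A : E →L[ℝ] E) (hq' : q' = q) :
      ContinuousLinearMap.bilinearComp (E := E) (F := E) (b q') A A v w =
        (show E →L[ℝ] E →L[ℝ] ℝ from b q) (A v) (A w) := by
    subst hq'
    rfl
  rw [hsymm, hsymm]
  exact hbase _ _ hleft

theorem trivializationAt_form_eq_formInChart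
    (b : ∀ q : M, TangentSpace I q →L[ℝ] TangentSpace I q →L[ℝ] ℝ) {c q : M}
    (hq : q ∈ (chartAt H c).source) :
    (trivializationAt (E →L[ℝ] E →L[ℝ] ℝ)
      (fun q : M => TangentSpace I q →L[ℝ] TangentSpace I q →L[ℝ] ℝ) c ⟨q, b q⟩).2 =
      formInChart I b c (extChartAt I c q) := by
  rw [hom_trivializationAt_apply]
  refine ContinuousLinearMap.ext fun v => ContinuousLinearMap.ext fun w => ?_
  rw [formInChart_extChartAt_apply I b hq]
  refine (inCoordinates_apply_eq₂ (F₁ := E) (E₁ := TangentSpace I) (F₂ := E)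
    (E₂ := TangentSpace I) (F₃ := ℝ) (E₃ := Bundle.Trivial M ℝ) (ϕ := b q) (v := v) (w := w)
    (x₀ := c) (x := q) (by simpa using hq) (by simpa using hq) (by simp)).trans ?_
  simp

variable {I} {b : ∀ q : M, TangentSpace I q →L[ℝ] TangentSpace I q →L[ℝ] ℝ}

set_option maxSynthPendingDepth 3 in
theorem contDiffOn_formInChart
    (hb : ContMDiff I (I.prod 𝓘(ℝ, E →L[ℝ] E →L[ℝ] ℝ)) ∞
      (fun q => TotalSpace.mk' (E →L[ℝ] E →L[ℝ] ℝ)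
        (E := fun q : M => TangentSpace I q →L[ℝ] TangentSpace I q →L[ℝ] ℝ) q (b q))) (c : M) :
    ContDiffOn ℝ ∞ (formInChart I b c) (extChartAt I c).target := by
  intro x hx
  have hsource : ∀ y ∈ (extChartAt I c).target,
      (extChartAt I c).symm y ∈ (chartAt H c).source := fun y hy =>
    extChartAt_source I c ▸ (extChartAt I c).map_target hy
  have hsection : ContMDiffAt I 𝓘(ℝ, E →L[ℝ] E →L[ℝ] ℝ) ∞ (fun q =>
      (trivializationAt (E →L[ℝ] E →L[ℝ] ℝ)
        (fun q : M => TangentSpace I q →L[ℝ] TangentSpace I q →L[ℝ] ℝ) c ⟨q, b q⟩).2)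
      ((extChartAt I c).symm x) :=
    (Bundle.Trivialization.contMDiffAt_section_iff _ (by simpa using hsource x hx)).1
      hb.contMDiffAt
  have hsymm : ContMDiffAt 𝓘(ℝ, E) I ∞ (extChartAt I c).symm x :=
    (contMDiffOn_extChartAt_symm c).contMDiffAt ((isOpen_extChartAt_target c).mem_nhds hx)
  refine ((hsection.comp x hsymm).contDiffAt.congr_of_eventuallyEq ?_).contDiffWithinAt
  filter_upwards [(isOpen_extChartAt_target c).mem_nhds hx] with y hy
  rw [comp_apply, trivializationAt_form_eq_formInChart I b (hsource y hy),
    (extChartAt I c).right_inv hy]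

theorem contMDiff_of_contDiffOn_formInChart
    (hb : ∀ c : M, ContDiffOn ℝ ∞ (formInChart I b c) (extChartAt I c).target) :
    ContMDiff I (I.prod 𝓘(ℝ, E →L[ℝ] E →L[ℝ] ℝ)) ∞
      (fun q => TotalSpace.mk' (E →L[ℝ] E →L[ℝ] ℝ)
        (E := fun q : M => TangentSpace I q →L[ℝ] TangentSpace I q →L[ℝ] ℝ) q (b q)) := by
  intro c
  rw [Bundle.contMDiffAt_section]
  have hform : ContMDiffAt 𝓘(ℝ, E) 𝓘(ℝ, E →L[ℝ] E →L[ℝ] ℝ) ∞ (formInChart I b c)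
      (extChartAt I c c) :=
    ((hb c).contDiffAt (extChartAt_target_mem_nhds c)).contMDiffAt
  refine (hform.comp c contMDiffAt_extChartAt).congr_of_eventuallyEq ?_
  filter_upwards [(chartAt H c).open_source.mem_nhds (mem_chart_source H c)] with q hq
  exact trivializationAt_form_eq_formInChart I b hq

theorem abs_fderiv_le_norm_riemGradient_mul [FiniteDimensional ℝ E]
    [RiemannianBundle (fun x : M => TangentSpace I x)] (f : M → ℝ) (c : M) {x : E}
    (hx : x ∈ (extChartAt I c).target)
    (hf : MDifferentiableAt I 𝓘(ℝ, ℝ) f ((extChartAt I c).symm x)) (u : E) :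
    |fderiv ℝ (f ∘ (extChartAt I c).symm) x u| ≤
      ‖riemGradient I f ((extChartAt I c).symm x)‖ * √(metricInChart I c x u u) := by
  have hM : IsManifold I 1 M := .of_le (n := ∞) (by simp)
  set q : M := (extChartAt I c).symm x
  have : FiniteDimensional ℝ (TangentSpace I q) := inferInstanceAs (FiniteDimensional ℝ E)
  have : CompleteSpace (TangentSpace I q) := FiniteDimensional.complete ℝ _
  have hsymm : MDifferentiableAt 𝓘(ℝ, E) I (extChartAt I c).symm x :=
    ((contMDiffOn_extChartAt_symm (n := 1) c).contMDiffAt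
      ((isOpen_extChartAt_target c).mem_nhds hx)).mdifferentiableAt (by simp)
  let w : TangentSpace I q := mfderiv 𝓘(ℝ, E) I (extChartAt I c).symm x u
  have hchain : fderiv ℝ (f ∘ (extChartAt I c).symm) x u = mfderiv I 𝓘(ℝ, ℝ) f q w := by
    rw [← mfderiv_eq_fderiv, mfderiv_comp x hf hsymm]
    rfl
  have hgrad : (mfderiv I 𝓘(ℝ, ℝ) f q : TangentSpace I q → ℝ) w =
      inner ℝ (riemGradient I f q) w :=
    (InnerProductSpace.toDual_symm_apply (𝕜 := ℝ)).symm
  have hnorm : √(metricInChart I c x u u) = ‖w‖ := (norm_eq_sqrt_real_inner w).symm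
  rw [hchain, hnorm]
  exact le_trans (le_of_eq (congrArg abs hgrad)) (abs_real_inner_le_norm _ _)

end TangentForms

section Distance

variable {E E' : Type*} [NormedAddCommGroup E] [NormedSpace ℝ E] [NormedAddCommGroup E']
  [NormedSpace ℝ E'] {H H' : Type*} [TopologicalSpace H] [TopologicalSpace H']
  {I : ModelWithCorners ℝ E H} {I' : ModelWithCorners ℝ E' H'}
  {M M' : Type*} [TopologicalSpace M] [ChartedSpace H M] [TopologicalSpace M']
  [ChartedSpace H' M'] [∀ x : M, ENorm (TangentSpace I x)] [∀ x : M', ENorm (TangentSpace I' x)]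
  [∀ x : M', ENormSMulClass ℝ (TangentSpace I' x)]

theorem riemannianEDist_map_le {f : M → M'} (hf : ContMDiff I I' 1 f)
    (hnorm : ∀ x (v : TangentSpace I x), ‖mfderiv I I' f x v‖ₑ ≤ ‖v‖ₑ) (x y : M) :
    riemannianEDist I' (f x) (f y) ≤ riemannianEDist I x y := by
  refine le_of_forall_gt fun r hr => ?_
  obtain ⟨γ, hγ0, hγ1, hγ, hlen⟩ := exists_lt_of_riemannianEDist_lt hr
  refine lt_of_le_of_lt ?_ hlen
  refine (riemannianEDist_le_pathELength (γ := f ∘ γ) (hf.comp_contMDiffOn hγ)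
    (congrArg f hγ0) (congrArg f hγ1) zero_le_one).trans ?_
  rw [pathELength_eq_lintegral_mfderiv_Ioo, pathELength_eq_lintegral_mfderiv_Ioo]
  refine MeasureTheory.setLIntegral_mono' measurableSet_Ioo fun t ht => ?_
  have hγt : MDifferentiableAt 𝓘(ℝ, ℝ) I γ t :=
    (hγ.contMDiffAt (Icc_mem_nhds ht.1 ht.2)).mdifferentiableAt one_ne_zero
  rw [mfderiv_comp t (hf.mdifferentiable one_ne_zero (γ t)) hγt]
  exact hnorm (γ t) _

theorem exists_isPreconnected_of_riemannianEDist_lt {x y : M} {ρ : ℝ≥0∞}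
    (hxy : riemannianEDist I x y < ρ) : ∃ Z : Set M, IsPreconnected Z ∧ x ∈ Z ∧ y ∈ Z := by
  obtain ⟨γ, hγ0, hγ1, hγ, -⟩ := exists_lt_of_riemannianEDist_lt hxy
  exact ⟨γ '' Icc 0 1, isPreconnected_Icc.image _ hγ.continuousOn, ⟨0, by simp, hγ0⟩,
    ⟨1, by simp, hγ1⟩⟩

end Distance

section CylinderMetric

theorem extChartAt_rayOne_source (r₀ : rayOne) : (extChartAt 𝓘(ℝ, ℝ) r₀).source = univ := by
  rw [extChartAt_source, TopologicalSpace.Opens.chartAt_eq]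
  simp [chartAt_self_eq]

theorem extChartAt_rayOne_target (r₀ : rayOne) : (extChartAt 𝓘(ℝ, ℝ) r₀).target = Ioi 1 := by
  rw [← (extChartAt 𝓘(ℝ, ℝ) r₀).image_source_eq_target, extChartAt_rayOne_source, image_univ]
  exact Subtype.range_coe

theorem extChartAt_rayOne_symm_apply (r₀ : rayOne) {x : ℝ} (hx : 1 < x) :
    (extChartAt 𝓘(ℝ, ℝ) r₀).symm x = ⟨x, hx⟩ :=
  Subtype.ext ((extChartAt 𝓘(ℝ, ℝ) r₀).right_inv (extChartAt_rayOne_target r₀ ▸ hx))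

theorem hasMFDerivAt_extChartAt_rayOne_symm (r₀ : rayOne) {x : ℝ} (hx : 1 < x) :
    HasMFDerivAt 𝓘(ℝ, ℝ) 𝓘(ℝ, ℝ) (extChartAt 𝓘(ℝ, ℝ) r₀).symm x
      (ContinuousLinearMap.id ℝ ℝ) := by
  refine ⟨continuousAt_extChartAt_symm'' (extChartAt_rayOne_target r₀ ▸ hx), ?_⟩
  refine ((hasFDerivAt_id x).congr_of_eventuallyEq ?_).hasFDerivWithinAt
  filter_upwards [isOpen_Ioi.mem_nhds hx] with y hy
  exact congrArg Subtype.val (extChartAt_rayOne_symm_apply r₀ hy)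

variable {n : ℕ} {Y : Type*} [TopologicalSpace Y] [ChartedSpace (𝔼 n) Y] [IsManifold (𝓡 n) ∞ Y]
  (h : ContMDiffRiemannianMetric (𝓡 n) ∞ (𝔼 n) (fun y : Y => TangentSpace (𝓡 n) y))

theorem extChartAt_cylinder (c : CylindricalEnd h) :
    extChartAt (𝓒 n) c = (extChartAt (𝓡 n) c.1).prod (extChartAt 𝓘(ℝ, ℝ) c.2) :=
  extChartAt_prod (I := 𝓡 n) (I' := 𝓘(ℝ, ℝ)) (M := Y) (M' := rayOne) c

theorem extChartAt_cylinder_apply (c p : CylindricalEnd h) :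
    extChartAt (𝓒 n) c p = (extChartAt (𝓡 n) c.1 p.1, (p.2 : ℝ)) := by
  rw [extChartAt_cylinder]
  rfl

theorem extChartAt_cylinder_target (c : CylindricalEnd h) :
    (extChartAt (𝓒 n) c).target = (extChartAt (𝓡 n) c.1).target ×ˢ Ioi 1 := by
  rw [extChartAt_cylinder, PartialEquiv.prod_target, extChartAt_rayOne_target]

theorem mem_extChartAt_cylinder_source {c p : CylindricalEnd h} :
    p ∈ (extChartAt (𝓒 n) c).source ↔ p.1 ∈ (extChartAt (𝓡 n) c.1).source := by
  rw [extChartAt_cylinder h, PartialEquiv.prod_source, extChartAt_rayOne_source]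
  exact and_iff_left trivial

theorem extChartAt_cylinder_symm_apply (c : CylindricalEnd h) (x : 𝔼 n) {r : ℝ} (hr : 1 < r) :
    (extChartAt (𝓒 n) c).symm (x, r) = ((extChartAt (𝓡 n) c.1).symm x, (⟨r, hr⟩ : rayOne)) := by
  rw [extChartAt_cylinder, ← extChartAt_rayOne_symm_apply c.2 hr]
  rfl

theorem mfderiv_extChartAt_cylinder_symm (c : CylindricalEnd h) {x : 𝔼 n}
    (hx : x ∈ (extChartAt (𝓡 n) c.1).target) {r : ℝ} (hr : 1 < r) (v : 𝔼 n) (s : ℝ) :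
    (show 𝔼 n × ℝ from
      mfderiv 𝓘(ℝ, 𝔼 n × ℝ) (𝓒 n) (extChartAt (𝓒 n) c).symm (x, r) (v, s)) =
      (mfderiv 𝓘(ℝ, 𝔼 n) (𝓡 n) (extChartAt (𝓡 n) c.1).symm x v, s) := by
  have hM : IsManifold (𝓡 n) 1 Y := .of_le (n := ∞) (by simp)
  have hbase : MDifferentiableAt 𝓘(ℝ, 𝔼 n) (𝓡 n) (extChartAt (𝓡 n) c.1).symm x :=
    ((contMDiffOn_extChartAt_symm (n := 1) c.1).contMDiffAt
      ((isOpen_extChartAt_target c.1).mem_nhds hx)).mdifferentiableAt (by simp)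
  have hray := hasMFDerivAt_extChartAt_rayOne_symm c.2 hr
  have hprod := HasMFDerivAt.prodMap (p := (x, r)) hbase.hasMFDerivAt hray
  rw [hray.mfderiv] at hprod
  have hcyl : HasMFDerivAt 𝓘(ℝ, 𝔼 n × ℝ) (𝓒 n) (M' := Y × rayOne)
      (Prod.map (extChartAt (𝓡 n) c.1).symm (extChartAt 𝓘(ℝ, ℝ) c.2).symm) (x, r)
      ((mfderiv 𝓘(ℝ, 𝔼 n) (𝓡 n) (extChartAt (𝓡 n) c.1).symm x).prodMap
        (ContinuousLinearMap.id ℝ ℝ)) := by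
    rw [modelWithCornersSelf_prod, ← chartedSpaceSelf_prod]
    exact hprod
  rw [extChartAt_cylinder]
  exact congrArg (fun A : 𝔼 n × ℝ →L[ℝ] 𝔼 n × ℝ => A (v, s)) hcyl.mfderiv

/-- The metric `dr² + h` in the coordinates on `Y × ℝ` given by the chart of `Y` around `c`. Here
`r` ranges over all of `ℝ`, so that it makes sense at translates of points of the cylinder. -/
noncomputable abbrev cylMetric (c : Y) (z : 𝔼 n × ℝ) : 𝔼 n × ℝ →L[ℝ] 𝔼 n × ℝ →L[ℝ] ℝ :=
  addSqForm (formInChart (𝓡 n) h.inner c z.1)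

theorem metricInChart_cylinder_eq (c : CylindricalEnd h) {z : 𝔼 n × ℝ}
    (hz : z ∈ (extChartAt (𝓡 n) c.1).target ×ˢ Ioi (1 : ℝ)) :
    metricInChart (𝓒 n) c z = cylMetric h c.1 z := by
  obtain ⟨x, r⟩ := z
  refine ContinuousLinearMap.ext fun ⟨v, s⟩ => ContinuousLinearMap.ext fun ⟨w, t⟩ => ?_
  have hbase : ((extChartAt (𝓒 n) c).symm (x, r)).1 = (extChartAt (𝓡 n) c.1).symm x := by
    rw [extChartAt_cylinder_symm_apply h c x hz.2]
  have happly (q : Y) (v' w' : 𝔼 n × ℝ) (hq : q = (extChartAt (𝓡 n) c.1).symm x)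
      (hv' : v' = (mfderiv 𝓘(ℝ, 𝔼 n) (𝓡 n) (extChartAt (𝓡 n) c.1).symm x v, s))
      (hw' : w' = (mfderiv 𝓘(ℝ, 𝔼 n) (𝓡 n) (extChartAt (𝓡 n) c.1).symm x w, t)) :
      (show 𝔼 n →L[ℝ] 𝔼 n →L[ℝ] ℝ from h.inner q) v'.1 w'.1 + v'.2 * w'.2 =
        formInChart (𝓡 n) h.inner c.1 x v w + s * t := by
    subst hq hv' hw'
    rfl
  exact happly _ _ _ hbase (mfderiv_extChartAt_cylinder_symm h c hz.1 hz.2 v s)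
    (mfderiv_extChartAt_cylinder_symm h c hz.1 hz.2 w t)

theorem contDiffOn_addSqForm {P F : Type*} [NormedAddCommGroup P] [NormedSpace ℝ P]
    [NormedAddCommGroup F] [NormedSpace ℝ F] {b : P → F →L[ℝ] F →L[ℝ] ℝ} {s : Set P}
    {k : WithTop ℕ∞} (hb : ContDiffOn ℝ k b s) :
    ContDiffOn ℝ k (fun p => addSqForm (b p)) s := by
  unfold addSqForm ContinuousLinearMap.bilinearComp
  exact (contDiffOn_clm_flip ((contDiffOn_clm_flip (hb.clm_comp contDiffOn_const)).clm_comp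
    contDiffOn_const)).add contDiffOn_const

theorem contDiffOn_cylMetric (c : Y) :
    ContDiffOn ℝ ∞ (cylMetric h c) ((extChartAt (𝓡 n) c).target ×ˢ univ) :=
  contDiffOn_addSqForm <|
    (contDiffOn_formInChart h.contMDiff c).comp contDiffOn_fst fun _ hz => hz.1

theorem cylMetric_pos (c : Y) {z : 𝔼 n × ℝ}
    (hz : z ∈ (extChartAt (𝓡 n) c).target ×ˢ (univ : Set ℝ)) {v : 𝔼 n × ℝ} (hv : v ≠ 0) :
    0 < cylMetric h c z v v := by
  have hM : IsManifold (𝓡 n) 1 Y := .of_le (n := ∞) (by simp)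
  refine addSqForm_pos _ (fun u hu => h.pos _ _ fun h0 => hu ?_) v hv
  have hinv := isInvertible_mfderivWithin_extChartAt_symm (I := 𝓡 n) hz.1
  rw [ModelWithCorners.range_eq_univ, mfderivWithin_univ] at hinv
  exact hinv.injective (h0.trans (map_zero _).symm)

instance : IsContinuousRiemannianBundle (𝔼 n × ℝ)
    (fun p : CylindricalEnd h => TangentSpace (𝓒 n) p) := by
  refine ⟨(cylinderMetric h).inner, ?_, fun p v w => rfl⟩
  refine (contMDiff_of_contDiffOn_formInChart (I := 𝓒 n) fun c => ?_).continuous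
  rw [extChartAt_cylinder_target]
  exact ((contDiffOn_cylMetric h c.1).mono (prod_mono_right (subset_univ _))).congr
    fun z hz => metricInChart_cylinder_eq h c hz

end CylinderMetric

theorem exists_forall_mem_of_eventually {ι X : Type*} [TopologicalSpace X] [Finite ι]
    {K : ι → Set X} (hK : ∀ i, IsCompact (K i)) {Q : ι → X → ℝ → Prop}
    (hloc : ∀ i, ∀ x ∈ K i, ∃ C, ∀ᶠ x' in 𝓝 x, Q i x' C)
    (hmono : ∀ i x C C', C ≤ C' → Q i x C → Q i x C') :
    ∃ C, ∀ i, ∀ x ∈ K i, Q i x C := by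
  have hQ (i : ι) : ∃ C, ∀ x ∈ K i, Q i x C := by
    refine (hK i).induction_on (p := fun s => ∃ C, ∀ x ∈ s, Q i x C) ⟨0, fun x hx => hx.elim⟩ ?_ ?_
      fun x hx => ?_
    · rintro s t hst ⟨C, hC⟩
      exact ⟨C, fun x hx => hC x (hst hx)⟩
    · rintro s t ⟨C, hC⟩ ⟨C', hC'⟩
      exact ⟨max C C', fun x hx => hx.elim
        (fun hx => hmono i x _ _ (le_max_left _ _) (hC x hx))
        fun hx => hmono i x _ _ (le_max_right _ _) (hC' x hx)⟩
    · obtain ⟨C, hC⟩ := hloc i x hx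
      exact ⟨_, mem_nhdsWithin_of_mem_nhds hC, C, fun x' hx' => hx'⟩
  choose C hC using hQ
  obtain ⟨C₀, hC₀⟩ := Finite.exists_le C
  exact ⟨C₀, fun i x hx => hmono i x _ _ (hC₀ i) (hC i x hx)⟩

section Translates

variable {n : ℕ} {Y : Type*} [TopologicalSpace Y] [ChartedSpace (𝔼 n) Y]

theorem extChartAt_prod_real_apply (c z : Y × ℝ) :
    extChartAt (𝓒 n) c z = (extChartAt (𝓡 n) c.1 z.1, z.2) := by
  rw [extChartAt_prod]
  rfl

theorem extChartAt_prod_real_target (c : Y × ℝ) :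
    (extChartAt (𝓒 n) c).target = (extChartAt (𝓡 n) c.1).target ×ˢ univ := by
  rw [extChartAt_prod, PartialEquiv.prod_target, extChartAt_model_space_eq_id]
  rfl

theorem mem_extChartAt_prod_real_source {c z : Y × ℝ} :
    z ∈ (extChartAt (𝓒 n) c).source ↔ z.1 ∈ (extChartAt (𝓡 n) c.1).source := by
  rw [extChartAt_prod, PartialEquiv.prod_source, extChartAt_model_space_eq_id]
  exact and_iff_left trivial

variable [IsManifold (𝓡 n) ∞ Y]
  {h : ContMDiffRiemannianMetric (𝓡 n) ∞ (𝔼 n) (fun y : Y => TangentSpace (𝓡 n) y)}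

/-- The coordinate `r` on the cylindrical end `Y × (1, ∞)_r`. -/
def cylCoord (p : CylindricalEnd h) : ℝ := (p.2 : ℝ)

/-- The translate of a point of the cylindrical end by `-τ` along the half-line. It need not lie on
the cylindrical end, so it is taken in `Y × ℝ`. -/
def cylShift (τ : ℝ) (p : CylindricalEnd h) : Y × ℝ := (p.1, cylCoord p - τ)

/-- Near `p`, the function `ψ` on the cylindrical end is a translate along the half-line of the
function `f` on `Y × ℝ`, and the translation takes `z` to `p`. -/
def IsTranslateAt (ψ : CylindricalEnd h → ℝ) (p : CylindricalEnd h) (f : Y × ℝ → ℝ) (z : Y × ℝ) :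
    Prop :=
  ∃ τ, cylShift τ p = z ∧ ψ =ᶠ[𝓝 p] f ∘ cylShift τ

variable (h) in
/-- A point of the cylindrical end over `c`, serving as the centre of a chart: the charts do not
depend on its second coordinate. -/
def cylCenter (c : Y) : CylindricalEnd h := (c, (⟨2, by simp [rayOne]⟩ : rayOne))

theorem contMDiff_cylCoord :
    ContMDiff (𝓒 n) 𝓘(ℝ, ℝ) ∞ (cylCoord : CylindricalEnd h → ℝ) :=
  (contMDiff_subtype_val (I := 𝓘(ℝ, ℝ)) (U := rayOne)).comp
    (contMDiff_snd (I := 𝓡 n) (J := 𝓘(ℝ, ℝ)) (M := Y) (N := rayOne))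

theorem contMDiff_cylShift (τ : ℝ) :
    ContMDiff (𝓒 n) (𝓒 n) ∞ (cylShift τ : CylindricalEnd h → Y × ℝ) :=
  ContMDiff.prodMk (contMDiff_fst (I := 𝓡 n) (J := 𝓘(ℝ, ℝ)) (M := Y) (N := rayOne))
    (contMDiff_cylCoord.sub contMDiff_const)

theorem extChartAt_cylShift (τ : ℝ) (c : Y × ℝ) (p : CylindricalEnd h) :
    extChartAt (𝓒 n) c (cylShift τ p) = extChartAt (𝓒 n) (cylCenter h c.1) p + (0, -τ) := by
  rw [extChartAt_prod_real_apply, extChartAt_cylinder_apply]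
  simp [cylShift, cylCoord, cylCenter, sub_eq_add_neg]

theorem extChartAt_symm_translate (τ : ℝ) (c : Y × ℝ) {x : 𝔼 n × ℝ}
    (hx : x ∈ (extChartAt (𝓒 n) (cylCenter h c.1)).target) :
    (extChartAt (𝓒 n) c).symm (x + (0, -τ)) =
      cylShift τ ((extChartAt (𝓒 n) (cylCenter h c.1)).symm x) := by
  rw [extChartAt_cylinder_target] at hx
  obtain ⟨x, r⟩ := x
  rw [extChartAt_cylinder_symm_apply h _ x hx.2, extChartAt_prod, extChartAt_model_space_eq_id]
  simp [cylShift, cylCoord, cylCenter, sub_eq_add_neg]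

namespace IsTranslateAt

variable {ψ : CylindricalEnd h → ℝ} {p : CylindricalEnd h} {f : Y × ℝ → ℝ} {c z : Y × ℝ}

theorem fst_eq (hψ : IsTranslateAt ψ p f z) : p.1 = z.1 := by
  obtain ⟨τ, rfl, -⟩ := hψ
  rfl

theorem contMDiffAt (hψ : IsTranslateAt ψ p f z) (hf : ContMDiff (𝓒 n) 𝓘(ℝ, ℝ) ∞ f) :
    ContMDiffAt (𝓒 n) 𝓘(ℝ, ℝ) ∞ ψ p := by
  obtain ⟨τ, -, hev⟩ := hψ
  exact (hf.comp (contMDiff_cylShift τ)).contMDiffAt.congr_of_eventuallyEq hev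

theorem mem_extChartAt_source (hψ : IsTranslateAt ψ p f z)
    (hz : z ∈ (extChartAt (𝓒 n) c).source) : p ∈ (extChartAt (𝓒 n) (cylCenter h c.1)).source :=
  (mem_extChartAt_cylinder_source h).2 (hψ.fst_eq ▸ mem_extChartAt_prod_real_source.1 hz)

theorem exists_eventually_chart_eq (hψ : IsTranslateAt ψ p f z)
    (hz : z ∈ (extChartAt (𝓒 n) c).source) :
    ∃ τ, extChartAt (𝓒 n) c z = extChartAt (𝓒 n) (cylCenter h c.1) p + (0, -τ) ∧
      (∀ᶠ x in 𝓝 (extChartAt (𝓒 n) (cylCenter h c.1) p),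
        (ψ ∘ (extChartAt (𝓒 n) (cylCenter h c.1)).symm) x =
          (f ∘ (extChartAt (𝓒 n) c).symm) (x + (0, -τ))) ∧
      ∀ᶠ x in 𝓝 (extChartAt (𝓒 n) (cylCenter h c.1) p),
        metricInChart (𝓒 n) (cylCenter h c.1) x = cylMetric h c.1 (x + (0, -τ)) := by
  have hp := hψ.mem_extChartAt_source hz
  obtain ⟨τ, rfl, hev⟩ := hψ
  set φ := extChartAt (𝓒 n) (cylCenter h c.1)
  have htarget : φ.target ∈ 𝓝 (φ p) := (isOpen_extChartAt_target _).mem_nhds (φ.map_source hp)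
  have hsymm : Tendsto φ.symm (𝓝 (φ p)) (𝓝 p) := by
    have := continuousAt_extChartAt_symm' hp
    rwa [ContinuousAt, φ.left_inv hp] at this
  refine ⟨τ, extChartAt_cylShift τ c p, ?_, ?_⟩
  · filter_upwards [hsymm.eventually hev, htarget] with x hx hxt
    rw [comp_apply, comp_apply, hx, comp_apply, extChartAt_symm_translate τ c hxt]
  · filter_upwards [htarget] with x hx
    rw [extChartAt_cylinder_target] at hx
    rw [metricInChart_cylinder_eq h _ hx]
    simp [cylMetric, cylCenter]

theorem metricInChart_eq (hψ : IsTranslateAt ψ p f z) (hz : z ∈ (extChartAt (𝓒 n) c).source) :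
    metricInChart (𝓒 n) (cylCenter h c.1) (extChartAt (𝓒 n) (cylCenter h c.1) p) =
      cylMetric h c.1 (extChartAt (𝓒 n) c z) := by
  obtain ⟨τ, hτ, -, hmetric⟩ := hψ.exists_eventually_chart_eq hz
  rw [hτ, hmetric.self_of_nhds]

theorem fderiv_eq (hψ : IsTranslateAt ψ p f z) (hz : z ∈ (extChartAt (𝓒 n) c).source) :
    fderiv ℝ (ψ ∘ (extChartAt (𝓒 n) (cylCenter h c.1)).symm)
        (extChartAt (𝓒 n) (cylCenter h c.1) p) =
      fderiv ℝ (f ∘ (extChartAt (𝓒 n) c).symm) (extChartAt (𝓒 n) c z) := by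
  obtain ⟨τ, hτ, hfun, -⟩ := hψ.exists_eventually_chart_eq hz
  rw [EventuallyEq.fderiv_eq (f := fun x => (f ∘ (extChartAt (𝓒 n) c).symm) (x + (0, -τ))) hfun,
    fderiv_comp_add_right, hτ]

theorem iteratedCovDeriv_eq (hψ : IsTranslateAt ψ p f z)
    (hz : z ∈ (extChartAt (𝓒 n) c).source) (j : ℕ) :
    iteratedCovDeriv (𝓒 n) ψ (cylCenter h c.1) j (extChartAt (𝓒 n) (cylCenter h c.1) p) =
      coordCovDeriv (cylMetric h c.1) (f ∘ (extChartAt (𝓒 n) c).symm) j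
        (extChartAt (𝓒 n) c z) := by
  obtain ⟨τ, hτ, hfun, hmetric⟩ := hψ.exists_eventually_chart_eq hz
  rw [iteratedCovDeriv_eq_coordCovDeriv, hτ,
    (eventually_coordCovDeriv_eq_translate hmetric hfun j).self_of_nhds]

end IsTranslateAt

variable {f : Y × ℝ → ℝ}

theorem exists_eventually_iteratedCovDeriv_le (hf : ContMDiff (𝓒 n) 𝓘(ℝ, ℝ) ∞ f) (j : ℕ)
    (z : Y × ℝ) :
    ∃ C, ∀ᶠ z' in 𝓝 z, ∀ (ψ : CylindricalEnd h → ℝ) (p : CylindricalEnd h),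
      IsTranslateAt ψ p f z' →
        ∃ c : CylindricalEnd h, p ∈ (chartAt (ModelProd (𝔼 n) ℝ) c).source ∧
          ∀ v : Fin j → 𝔼 n × ℝ,
            |iteratedCovDeriv (𝓒 n) ψ c j (extChartAt (𝓒 n) c p) v| ≤
              C * ∏ i, √(metricInChart (𝓒 n) c (extChartAt (𝓒 n) c p) (v i) (v i)) := by
  set φ := extChartAt (𝓒 n) z
  have hopen : IsOpen φ.target := isOpen_extChartAt_target z
  obtain ⟨K, hK, hzK, hKφ⟩ := exists_compact_subset hopen (mem_extChartAt_target z)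
  have htarget := extChartAt_prod_real_target (n := n) z
  obtain ⟨C, hC⟩ := exists_coordCovDeriv_le (f := f ∘ φ.symm) hopen
    (htarget ▸ contDiffOn_cylMetric h z.1) (fun x hx v => cylMetric_pos h z.1 (htarget ▸ hx))
    (fun x hx => (contDiffAt_comp_extChartAt_symm hf hx).contDiffWithinAt) hK hKφ j
  refine ⟨C, ?_⟩
  filter_upwards [(continuousAt_extChartAt z).preimage_mem_nhds (mem_interior_iff_mem_nhds.1 hzK),
    extChartAt_source_mem_nhds (I := 𝓒 n) z] with z' hz'K hz' ψ p hψ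
  refine ⟨cylCenter h z.1, by simpa using hψ.mem_extChartAt_source hz', fun v => ?_⟩
  rw [hψ.iteratedCovDeriv_eq hz', hψ.metricInChart_eq hz']
  exact hC _ hz'K v

theorem isCbInfty_of_isTranslateAt {ι : Type*} [Finite ι] {f : ι → Y × ℝ → ℝ}
    (hf : ∀ i, ContMDiff (𝓒 n) 𝓘(ℝ, ℝ) ∞ (f i)) {K : Set (Y × ℝ)} (hK : IsCompact K)
    {ψ : CylindricalEnd h → ℝ} (hψ : ∀ p, ∃ i, ∃ z ∈ K, IsTranslateAt ψ p (f i) z) :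
    IsCbInfty (𝓒 n) ψ := by
  refine ⟨fun p => ?_, fun j => ?_⟩
  · obtain ⟨i, z, -, hp⟩ := hψ p
    exact hp.contMDiffAt (hf i)
  obtain ⟨C, hC⟩ := exists_forall_mem_of_eventually (fun _ : ι => hK)
    (fun i z _ => exists_eventually_iteratedCovDeriv_le (h := h) (hf i) j z)
    fun i z C C' hCC' hC ψ p hp => by
      obtain ⟨c, hc, hv⟩ := hC ψ p hp
      refine ⟨c, hc, fun v => (hv v).trans ?_⟩
      gcongr
  refine ⟨C, fun p => ?_⟩
  obtain ⟨i, z, hz, hp⟩ := hψ p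
  exact hC i z hz ψ p hp

theorem exists_eventually_one_le_mul_norm_riemGradient (hf : ContMDiff (𝓒 n) 𝓘(ℝ, ℝ) ∞ f)
    {z : Y × ℝ} (hz : mfderiv (𝓒 n) 𝓘(ℝ, ℝ) f z ≠ 0) :
    ∃ C, ∀ᶠ z' in 𝓝 z, ∀ (ψ : CylindricalEnd h → ℝ) (p : CylindricalEnd h),
      IsTranslateAt ψ p f z' → 1 ≤ C * ‖riemGradient (𝓒 n) ψ p‖ := by
  set φ := extChartAt (𝓒 n) z with hφ
  obtain ⟨u, hu⟩ : ∃ u, fderiv ℝ (f ∘ φ.symm) (φ z) u ≠ 0 := by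
    rw [(hf.mdifferentiable (by simp) z).mfderiv, ModelWithCorners.range_eq_univ,
      fderivWithin_univ] at hz
    exact DFunLike.ne_iff.1 hz
  have htarget := extChartAt_prod_real_target (n := n) z
  let A (x : 𝔼 n × ℝ) : ℝ := √(cylMetric h z.1 x u u) / |fderiv ℝ (f ∘ φ.symm) x u|
  have hfderiv : ContinuousAt (fun x => fderiv ℝ (f ∘ φ.symm) x u) (φ z) :=
    ((contDiffAt_comp_extChartAt_symm hf (mem_extChartAt_target z)).continuousAt_fderiv
      (by simp)).clm_apply continuousAt_const
  have hA : ContinuousAt A (φ z) := by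
    have hmetric : ContinuousAt (cylMetric h z.1) (φ z) :=
      (contDiffOn_cylMetric h z.1).continuousOn.continuousAt
        (htarget ▸ extChartAt_target_mem_nhds z)
    exact ((hmetric.clm_apply continuousAt_const).clm_apply continuousAt_const).sqrt.div
      hfderiv.abs (abs_ne_zero.2 hu)
  refine ⟨A (φ z) + 1, ?_⟩
  have hφz : Tendsto φ (𝓝 z) (𝓝 (φ z)) := continuousAt_extChartAt z
  filter_upwards [hφz.eventually (hA.eventually (gt_mem_nhds (lt_add_one _))),
    hφz.eventually (hfderiv.eventually_ne hu), extChartAt_source_mem_nhds (I := 𝓒 n) z]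
    with z' hAz' huz' hz' ψ p hψ
  have hp := hψ.mem_extChartAt_source hz'
  have hgrad := abs_fderiv_le_norm_riemGradient_mul (I := 𝓒 n) ψ (cylCenter h z.1)
    ((extChartAt (𝓒 n) (cylCenter h z.1)).map_source hp) (by
      rw [(extChartAt (𝓒 n) (cylCenter h z.1)).left_inv hp]
      exact (hψ.contMDiffAt hf).mdifferentiableAt (by simp)) u
  rw [hψ.fderiv_eq hz', hψ.metricInChart_eq hz',
    (extChartAt (𝓒 n) (cylCenter h z.1)).left_inv hp] at hgrad
  calc 1 = |fderiv ℝ (f ∘ φ.symm) (φ z') u| / |fderiv ℝ (f ∘ φ.symm) (φ z') u| :=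
        (div_self (abs_ne_zero.2 huz')).symm
    _ ≤ ‖riemGradient (𝓒 n) ψ p‖ * √(cylMetric h z.1 (φ z') u u) /
          |fderiv ℝ (f ∘ φ.symm) (φ z') u| := by gcongr
    _ = A (φ z') * ‖riemGradient (𝓒 n) ψ p‖ := by ring
    _ ≤ (A (φ z) + 1) * ‖riemGradient (𝓒 n) ψ p‖ := by gcongr

theorem exists_pos_le_norm_riemGradient {ι : Type*} [Finite ι] {f : ι → Y × ℝ → ℝ}
    (hf : ∀ i, ContMDiff (𝓒 n) 𝓘(ℝ, ℝ) ∞ (f i)) {K : ι → Set (Y × ℝ)}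
    (hK : ∀ i, IsCompact (K i)) (hcrit : ∀ i, ∀ z ∈ K i, mfderiv (𝓒 n) 𝓘(ℝ, ℝ) (f i) z ≠ 0) :
    ∃ ρ : ℝ, 0 < ρ ∧ ∀ (ψ : CylindricalEnd h → ℝ) (p : CylindricalEnd h) (i : ι),
      ∀ z ∈ K i, IsTranslateAt ψ p (f i) z → ρ ≤ ‖riemGradient (𝓒 n) ψ p‖ := by
  obtain ⟨C, hC⟩ := exists_forall_mem_of_eventually hK
    (fun i z hz => exists_eventually_one_le_mul_norm_riemGradient (h := h) (hf i) (hcrit i z hz))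
    fun i z C C' hCC' hC ψ p hψ => (hC ψ p hψ).trans (by gcongr)
  have hpos : 0 < max C 1 := lt_max_of_lt_right one_pos
  refine ⟨(max C 1)⁻¹, inv_pos.2 hpos, fun ψ p i z hz hψ => ?_⟩
  rw [inv_le_iff_one_le_mul₀' hpos]
  refine (hC i z hz ψ p hψ).trans ?_
  gcongr
  exact le_max_left _ _

end Translates

section CylinderDistance

theorem hasMFDerivAt_val_rayOne (r : rayOne) :
    HasMFDerivAt 𝓘(ℝ, ℝ) 𝓘(ℝ, ℝ) (Subtype.val : rayOne → ℝ) r (ContinuousLinearMap.id ℝ ℝ) := by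
  have hchart : writtenInExtChartAt 𝓘(ℝ, ℝ) 𝓘(ℝ, ℝ) r (Subtype.val : rayOne → ℝ)
      =ᶠ[𝓝 (r : ℝ)] id := by
    filter_upwards [isOpen_Ioi.mem_nhds (show (r : ℝ) ∈ Ioi 1 from r.2)] with y hy
    exact congrArg Subtype.val (extChartAt_rayOne_symm_apply r hy)
  exact ⟨continuousAt_subtype_val,
    ((hasFDerivAt_id _).congr_of_eventuallyEq hchart).hasFDerivWithinAt⟩

/-- The translation `r ↦ r + τ` of the half-line `(1, ∞)`, for `τ ≥ 0`. -/
def rayTranslate (τ : ℝ) (hτ : 0 ≤ τ) (r : rayOne) : rayOne :=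
  ⟨r + τ, (show (1 : ℝ) < r from r.2).trans_le (le_add_of_nonneg_right hτ)⟩

variable {τ : ℝ} (hτ : 0 ≤ τ)

theorem continuous_rayTranslate : Continuous (rayTranslate τ hτ) :=
  (continuous_subtype_val.add continuous_const).subtype_mk _

theorem extChartAt_comp_rayTranslate_eventuallyEq (r : rayOne) :
    extChartAt 𝓘(ℝ, ℝ) (rayTranslate τ hτ r) ∘ rayTranslate τ hτ ∘ (extChartAt 𝓘(ℝ, ℝ) r).symm
      =ᶠ[𝓝 (extChartAt 𝓘(ℝ, ℝ) r r)] fun y => y + τ := by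
  filter_upwards [isOpen_Ioi.mem_nhds (show (r : ℝ) ∈ Ioi 1 from r.2)] with y hy
  rw [comp_apply, comp_apply, extChartAt_rayOne_symm_apply r hy]
  rfl

theorem contMDiff_rayTranslate : ContMDiff 𝓘(ℝ, ℝ) 𝓘(ℝ, ℝ) ∞ (rayTranslate τ hτ) := fun r =>
  contMDiffAt_iff.2 ⟨(continuous_rayTranslate hτ).continuousAt,
    ((contDiffAt_id.add contDiffAt_const).congr_of_eventuallyEq
      (extChartAt_comp_rayTranslate_eventuallyEq hτ r)).contDiffWithinAt⟩

theorem hasMFDerivAt_rayTranslate (r : rayOne) :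
    HasMFDerivAt 𝓘(ℝ, ℝ) 𝓘(ℝ, ℝ) (rayTranslate τ hτ) r (ContinuousLinearMap.id ℝ ℝ) :=
  ⟨(continuous_rayTranslate hτ).continuousAt,
    (((hasFDerivAt_id _).add_const τ).congr_of_eventuallyEq
      (extChartAt_comp_rayTranslate_eventuallyEq hτ r)).hasFDerivWithinAt⟩

variable {n : ℕ} {Y : Type*} [TopologicalSpace Y] [ChartedSpace (𝔼 n) Y] [IsManifold (𝓡 n) ∞ Y]
  {h : ContMDiffRiemannianMetric (𝓡 n) ∞ (𝔼 n) (fun y : Y => TangentSpace (𝓡 n) y)}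

/-- The translation `(y, r) ↦ (y, r + τ)` of the cylindrical end, for `τ ≥ 0`. -/
def cylTranslate (τ : ℝ) (hτ : 0 ≤ τ) (p : CylindricalEnd h) : CylindricalEnd h :=
  (p.1, rayTranslate τ hτ p.2)

theorem contMDiff_cylTranslate :
    ContMDiff (𝓒 n) (𝓒 n) ∞ (cylTranslate τ hτ : CylindricalEnd h → CylindricalEnd h) :=
  ContMDiff.prodMap (I := 𝓡 n) (I' := 𝓡 n) (J := 𝓘(ℝ, ℝ)) (J' := 𝓘(ℝ, ℝ)) (f := (id : Y → Y))
    contMDiff_id (contMDiff_rayTranslate hτ)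

theorem mfderiv_cylTranslate (p : CylindricalEnd h) :
    (mfderiv (𝓒 n) (𝓒 n) (cylTranslate τ hτ : CylindricalEnd h → CylindricalEnd h) p :
      𝔼 n × ℝ →L[ℝ] 𝔼 n × ℝ) = ContinuousLinearMap.id ℝ (𝔼 n × ℝ) := by
  have hprod := HasMFDerivAt.prodMap (p := (show Y × rayOne from p))
    (hasMFDerivAt_id (I := 𝓡 n) p.1) (hasMFDerivAt_rayTranslate hτ p.2)
  rw [(hasMFDerivAt_id (I := 𝓡 n) _).mfderiv, (hasMFDerivAt_rayTranslate hτ _).mfderiv] at hprod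
  exact hprod.mfderiv

theorem enorm_mfderiv_cylTranslate (p : CylindricalEnd h) (v : TangentSpace (𝓒 n) p) :
    ‖mfderiv (𝓒 n) (𝓒 n) (cylTranslate τ hτ : CylindricalEnd h → CylindricalEnd h) p v‖ₑ =
      ‖v‖ₑ := by
  rw [enorm_eq_iff_norm_eq, norm_eq_sqrt_real_inner, norm_eq_sqrt_real_inner]
  exact congrArg (fun A : 𝔼 n × ℝ →L[ℝ] 𝔼 n × ℝ =>
    √(addSqForm (F := 𝔼 n) (h.inner p.1) (A v) (A v))) (mfderiv_cylTranslate hτ p)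

theorem riemannianEDist_cylTranslate_le (p q : CylindricalEnd h) :
    riemannianEDist (𝓒 n) (cylTranslate τ hτ p) (cylTranslate τ hτ q) ≤
      riemannianEDist (𝓒 n) p q :=
  riemannianEDist_map_le ((contMDiff_cylTranslate hτ).of_le (by simp))
    (fun p v => (enorm_mfderiv_cylTranslate hτ p v).le) p q

theorem mfderiv_cylCoord (p : CylindricalEnd h) :
    (mfderiv (𝓒 n) 𝓘(ℝ, ℝ) (cylCoord : CylindricalEnd h → ℝ) p : 𝔼 n × ℝ →L[ℝ] ℝ) =
      ContinuousLinearMap.snd ℝ (𝔼 n) ℝ :=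
  (HasMFDerivAt.comp (show Y × rayOne from p) (hasMFDerivAt_val_rayOne p.2)
    (hasMFDerivAt_snd (I := 𝓡 n) (I' := 𝓘(ℝ, ℝ)) (show Y × rayOne from p))).mfderiv

theorem enorm_mfderiv_cylCoord_le (p : CylindricalEnd h) (v : TangentSpace (𝓒 n) p) :
    ‖mfderiv (𝓒 n) 𝓘(ℝ, ℝ) (cylCoord : CylindricalEnd h → ℝ) p v‖ₑ ≤ ‖v‖ₑ := by
  let v' : 𝔼 n × ℝ := v
  let b : 𝔼 n →L[ℝ] 𝔼 n →L[ℝ] ℝ := h.inner p.1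
  have hderiv : mfderiv (𝓒 n) 𝓘(ℝ, ℝ) (cylCoord : CylindricalEnd h → ℝ) p v = v'.2 :=
    congrArg (fun A : 𝔼 n × ℝ →L[ℝ] ℝ => A v') (mfderiv_cylCoord p)
  have hinner : (inner ℝ v v : ℝ) = b v'.1 v'.1 + v'.2 * v'.2 :=
    addSqForm_apply (F := 𝔼 n) b v' v'
  have hnonneg : 0 ≤ b v'.1 v'.1 := by
    obtain hv | hv := eq_or_ne v'.1 0
    · rw [hv, map_zero]
    · exact (h.pos p.1 _ hv).le
  rw [enorm_tangentSpace_vectorSpace, hderiv, enorm_le_iff_norm_le, norm_eq_sqrt_real_inner v,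
    hinner, Real.norm_eq_abs]
  exact Real.abs_le_sqrt (by rw [sq]; exact le_add_of_nonneg_left hnonneg)

theorem abs_cylCoord_sub_lt_of_riemannianEDist_lt {p q : CylindricalEnd h} {ρ : ℝ}
    (hpq : riemannianEDist (𝓒 n) p q < ENNReal.ofReal ρ) : |cylCoord p - cylCoord q| < ρ := by
  have hle := riemannianEDist_map_le (contMDiff_cylCoord.of_le (by simp))
    (fun p v => enorm_mfderiv_cylCoord_le p v) p q
  rw [← IsRiemannianManifold.out, edist_dist, Real.dist_eq] at hle
  exact (ENNReal.ofReal_lt_ofReal_iff_of_nonneg (abs_nonneg _)).1 (hle.trans_lt hpq)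

end CylinderDistance

section PeriodicFunction

/-- The profile along the half-line of the function to be perturbed: a sine wave of period `4 * R`
whose critical points in the first period are `1 + R` and `1 + 3 * R`. -/
noncomputable def profile (R r : ℝ) : ℝ := 2 + 1 / 2 * Real.sin (Real.pi * (r - 1) / (2 * R))

theorem contDiff_profile (R : ℝ) : ContDiff ℝ ∞ (profile R) := by
  unfold profile
  fun_prop

theorem profile_sub_nat_mul {R : ℝ} (hR : 0 < R) (r : ℝ) (k : ℕ) :
    profile R (r - k * (4 * R)) = profile R r := by
  have hphase : Real.pi * (r - k * (4 * R) - 1) / (2 * R) =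
      Real.pi * (r - 1) / (2 * R) - k * (2 * Real.pi) := by
    field_simp
    ring
  rw [profile, hphase, Real.sin_sub_nat_mul_two_pi, profile]

theorem profile_mem_Icc (R r : ℝ) : profile R r ∈ Icc (3 / 2) (5 / 2) := by
  have hge := Real.neg_one_le_sin (Real.pi * (r - 1) / (2 * R))
  have hle := Real.sin_le_one (Real.pi * (r - 1) / (2 * R))
  constructor <;> unfold profile <;> linarith

theorem eq_or_eq_of_deriv_profile_eq_zero {R r : ℝ} (hR : 0 < R) (hr : r ∈ Icc 1 (1 + 4 * R))
    (hderiv : deriv (profile R) r = 0) : r = 1 + R ∨ r = 1 + 3 * R := by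
  have hprofile : HasDerivAt (profile R)
      (1 / 2 * (Real.cos (Real.pi * (r - 1) / (2 * R)) * (Real.pi * 1 / (2 * R)))) r :=
    ((((((hasDerivAt_id r).sub_const 1).const_mul Real.pi).div_const (2 * R)).sin).const_mul
      (1 / 2)).const_add 2
  have hcos : Real.cos (Real.pi * (r - 1) / (2 * R)) = 0 := by
    simpa [hprofile.deriv, Real.pi_ne_zero, hR.ne'] using hderiv
  obtain ⟨k, hk⟩ := Real.cos_eq_zero_iff.1 hcos
  have hrk : r - 1 = (2 * k + 1) * R := by
    field_simp at hk
    linarith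
  have hk0 : (0 : ℤ) ≤ 2 * k + 1 := by
    have : (0 : ℝ) ≤ 2 * k + 1 := nonneg_of_mul_nonneg_left (by linarith [hr.1]) hR
    exact_mod_cast this
  have hk4 : 2 * k + 1 ≤ (4 : ℤ) := by
    have : (2 * k + 1 : ℝ) ≤ 4 := le_of_mul_le_mul_right (by linarith [hr.2]) hR
    exact_mod_cast this
  obtain rfl | rfl : k = 0 ∨ k = 1 := by omega
  · exact .inl (by push_cast at hrk; linarith)
  · exact .inr (by push_cast at hrk; linarith)

variable {E : Type*} [NormedAddCommGroup E] [NormedSpace ℝ E] {H : Type*} [TopologicalSpace H]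
  {I : ModelWithCorners ℝ E H} {X : Type*} [TopologicalSpace X] [ChartedSpace H X]

theorem deriv_eq_zero_and_mfderiv_eq_zero_of_add {a : ℝ → ℝ} {b : X → ℝ} {z : X × ℝ}
    (ha : DifferentiableAt ℝ a z.2) (hb : MDifferentiableAt I 𝓘(ℝ, ℝ) b z.1)
    (hz : mfderiv (I.prod 𝓘(ℝ, ℝ)) 𝓘(ℝ, ℝ) (fun z : X × ℝ => a z.2 + b z.1) z = 0) :
    deriv a z.2 = 0 ∧ mfderiv I 𝓘(ℝ, ℝ) b z.1 = 0 := by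
  let B : E →L[ℝ] ℝ := mfderiv I 𝓘(ℝ, ℝ) b z.1
  have hsum : (fderiv ℝ a z.2).comp (ContinuousLinearMap.snd ℝ E ℝ) +
      B.comp (ContinuousLinearMap.fst ℝ E ℝ) = 0 :=
    ((ha.hasFDerivAt.hasMFDerivAt.comp z (hasMFDerivAt_snd z)).add
      (hb.hasMFDerivAt.comp z (hasMFDerivAt_fst z))).mfderiv.symm.trans hz
  refine ⟨by simpa using DFunLike.congr_fun hsum (0, 1), ContinuousLinearMap.ext fun v => ?_⟩
  calc B v = fderiv ℝ a z.2 0 + B v := by rw [map_zero, zero_add]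
    _ = 0 := DFunLike.congr_fun hsum (v, 0)

variable (I X) in
theorem exists_contMDiff_periodic_finite_critical [FiniteDimensional ℝ E] [I.Boundaryless]
    [IsManifold I ∞ X] [T2Space X] [CompactSpace X] {R : ℝ} (hR : 0 < R) :
    ∃ f : X × ℝ → ℝ, ContMDiff (I.prod 𝓘(ℝ, ℝ)) 𝓘(ℝ, ℝ) ∞ f ∧ (∀ z, f z ∈ Icc 1 3) ∧
      (∀ x r (k : ℕ), f (x, r - k * (4 * R)) = f (x, r)) ∧
      ∃ F : Set (X × ℝ), F.Finite ∧ F ⊆ univ ×ˢ Icc (1 + R) (1 + 3 * R) ∧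
        ∀ z ∈ univ ×ˢ Icc 1 (1 + 4 * R), mfderiv (I.prod 𝓘(ℝ, ℝ)) 𝓘(ℝ, ℝ) f z = 0 → z ∈ F := by
  obtain ⟨b, hb, hb_le, hb_crit⟩ :=
    exists_contMDiff_abs_le_finite_critical I X (show (0 : ℝ) < 1 / 2 by norm_num)
  refine ⟨fun z => profile R z.2 + b z.1,
    ((contDiff_profile R).contMDiff.comp contMDiff_snd).add (hb.comp contMDiff_fst), fun z => ?_,
    fun x r k => by simp only [profile_sub_nat_mul hR],
    {x | mfderiv I 𝓘(ℝ, ℝ) b x = 0} ×ˢ {1 + R, 1 + 3 * R}, hb_crit.prod (toFinite _), ?_,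
    fun z hz hz0 => ?_⟩
  · have hprofile := profile_mem_Icc R z.2
    have hbz := abs_le.1 (hb_le z.1)
    constructor <;> linarith [hprofile.1, hprofile.2]
  · refine prod_mono (subset_univ _) (insert_subset_iff.2 ⟨?_, singleton_subset_iff.2 ?_⟩) <;>
      constructor <;> linarith
  · obtain ⟨hr, hx⟩ := deriv_eq_zero_and_mfderiv_eq_zero_of_add
      ((contDiff_profile R).differentiable (by simp) _) (hb.mdifferentiable (by simp) _) hz0
    exact ⟨hx, eq_or_eq_of_deriv_profile_eq_zero hR hz.2 hr⟩

theorem exists_contMDiff_critical_subset [FiniteDimensional ℝ E] [I.Boundaryless]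
    [IsManifold I ∞ X] [T2Space X] [LocallyConnectedSpace X] {f : X → ℝ}
    (hf : ContMDiff I 𝓘(ℝ, ℝ) ∞ f) {F N U W : Set X} (hF : F.Finite) (hN : IsOpen N)
    (hU : IsOpen U) (hFN : F ⊆ N) (hNW : N ⊆ W)
    (hmeet : ∀ p ∈ F, (connectedComponentIn N p ∩ U).Nonempty)
    (hcrit : ∀ x ∈ W, mfderiv I 𝓘(ℝ, ℝ) f x = 0 → x ∈ F) :
    ∃ g : X → ℝ, ContMDiff I 𝓘(ℝ, ℝ) ∞ g ∧ EqOn g f Nᶜ ∧ range g ⊆ range f ∧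
      ∀ x ∈ W, mfderiv I 𝓘(ℝ, ℝ) g x = 0 → x ∈ U := by
  obtain ⟨Φ, hΦN, hΦF⟩ := exists_diffeomorph_mapsTo_of_finite (I := I) hF hN hU hFN hmeet
  refine ⟨f ∘ Φ.symm, hf.comp Φ.symm.contMDiff,
    fun x hx => congrArg f ((Φ.toEquiv.symm_apply_eq).2 (hΦN hx).symm), range_comp_subset_range _ _,
    fun x hx hx0 => ?_⟩
  obtain ⟨x, rfl⟩ : ∃ y, Φ y = x := Φ.surjective x
  refine hΦF (hcrit x ?_ ?_)
  · by_cases hxN : x ∈ N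
    · exact hNW hxN
    · rwa [hΦN hxN] at hx
  · have hcomp := mfderiv_comp x
      ((hf.comp Φ.symm.contMDiff).mdifferentiable (by simp) (Φ x))
      (Φ.contMDiff.mdifferentiable (by simp) x)
    have hsymm : (f ∘ Φ.symm) ∘ Φ = f := funext fun x => congrArg f (Φ.symm_apply_apply x)
    rw [hx0, hsymm] at hcomp
    exact hcomp.trans (ContinuousLinearMap.zero_comp _)

end PeriodicFunction

section Slabs

/-- The index `k` of the slab `1 + k * (4 * R) ≤ r < 1 + (k + 1) * (4 * R)` containing `r`. -/
noncomputable def slabIndex (R r : ℝ) : ℕ := ⌊(r - 1) / (4 * R)⌋₊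

theorem sub_slabIndex_mem_Ico {R r : ℝ} (hR : 0 < R) (hr : 1 < r) :
    r - slabIndex R r * (4 * R) ∈ Ico 1 (1 + 4 * R) := by
  have hle := (le_div_iff₀ (by positivity)).1
    (Nat.floor_le (div_nonneg (sub_nonneg.2 hr.le) (by positivity : 0 ≤ 4 * R)))
  have hlt := (div_lt_iff₀ (by positivity)).1 (Nat.lt_floor_add_one ((r - 1) / (4 * R)))
  constructor <;> rw [slabIndex] <;> linarith

theorem slabIndex_eq_or_add_one_eq {R r : ℝ} (hR : 0 < R) (hr : 1 < r) {k : ℕ}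
    (hk : r - k * (4 * R) ∈ Ioo (1 - R / 2) (1 + 4 * R)) :
    slabIndex R r = k ∨ slabIndex R r + 1 = k := by
  obtain ⟨hle, hlt⟩ := sub_slabIndex_mem_Ico hR hr
  set k' := slabIndex R r
  have hk' : (k' : ℝ) < k + 1 :=
    lt_of_mul_lt_mul_right (by linarith [hk.2]) (by positivity : 0 ≤ 4 * R)
  have hk : (k : ℝ) < k' + 2 :=
    lt_of_mul_lt_mul_right (by linarith [hk.1]) (by positivity : 0 ≤ 4 * R)
  norm_cast at hk hk'
  omega

/-- The middle part of the first slab of `Y × ℝ`. -/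
def slabCore (Y : Type*) (R : ℝ) : Set (Y × ℝ) := univ ×ˢ Ioo (1 + R / 2) (1 + 7 * R / 2)

variable {n : ℕ} {Y : Type*} [TopologicalSpace Y] [ChartedSpace (𝔼 n) Y] [IsManifold (𝓡 n) ∞ Y]
  {h : ContMDiffRiemannianMetric (𝓡 n) ∞ (𝔼 n) (fun y : Y => TangentSpace (𝓡 n) y)}

/-- The function on the cylindrical end that is, on the slab of index `k`, the translate of `g k`
from the first slab. -/
noncomputable def slabGlue (R : ℝ) (g : ℕ → Y × ℝ → ℝ) (p : CylindricalEnd h) : ℝ :=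
  g (slabIndex R (cylCoord p)) (cylShift (slabIndex R (cylCoord p) * (4 * R)) p)

theorem one_lt_cylCoord (p : CylindricalEnd h) : 1 < cylCoord p :=
  p.2.2

theorem isTranslateAt_slabGlue {R : ℝ} (hR : 0 < R) {f : Y × ℝ → ℝ} {g : ℕ → Y × ℝ → ℝ}
    (hf : ∀ y r (k : ℕ), f (y, r - k * (4 * R)) = f (y, r))
    (hg : ∀ k, EqOn (g k) f (slabCore Y R)ᶜ) (p : CylindricalEnd h) :
    IsTranslateAt (slabGlue R g) p (g (slabIndex R (cylCoord p)))
      (cylShift (slabIndex R (cylCoord p) * (4 * R)) p) := by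
  refine ⟨_, rfl, ?_⟩
  set k := slabIndex R (cylCoord p)
  obtain ⟨hle, hlt⟩ := sub_slabIndex_mem_Ico hR (one_lt_cylCoord p)
  have hnear : ∀ᶠ q : CylindricalEnd h in 𝓝 p,
      cylCoord q - k * (4 * R) ∈ Ioo (1 - R / 2) (1 + 4 * R) :=
    (contMDiff_cylCoord.continuous.sub continuous_const).continuousAt.preimage_mem_nhds
      (Ioo_mem_nhds (lt_of_lt_of_le (by linarith) hle) hlt)
  filter_upwards [hnear] with q hq
  obtain heq | hsucc := slabIndex_eq_or_add_one_eq hR (one_lt_cylCoord q) hq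
  · rw [slabGlue, heq, comp_apply]
  · have hk : (k : ℝ) = slabIndex R (cylCoord q) + 1 := by exact_mod_cast hsucc.symm
    have hq' := (sub_slabIndex_mem_Ico hR (one_lt_cylCoord q)).2
    have hcore : cylShift (k * (4 * R)) q ∉ slabCore Y R := fun hcore => by
      have : 1 + R / 2 < cylCoord q - k * (4 * R) := hcore.2.1
      rw [hk] at this
      linarith
    have hcore' : cylShift (slabIndex R (cylCoord q) * (4 * R)) q ∉ slabCore Y R := fun hcore => by
      have : cylCoord q - slabIndex R (cylCoord q) * (4 * R) < 1 + 7 * R / 2 := hcore.2.2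
      have := hq.1
      rw [hk] at this
      linarith
    rw [slabGlue, comp_apply, hg _ hcore, hg _ hcore', cylShift, cylShift, hf, hf]

end Slabs

section Network

variable {n : ℕ} {Y : Type*} [TopologicalSpace Y] [ChartedSpace (𝔼 n) Y] [IsManifold (𝓡 n) ∞ Y]
  (h : ContMDiffRiemannianMetric (𝓡 n) ∞ (𝔼 n) (fun y : Y => TangentSpace (𝓡 n) y))

/-- A retraction of `Y × ℝ` onto the part `3 / 2 ≤ r` of the cylindrical end. -/
noncomputable def toCyl (z : Y × ℝ) : CylindricalEnd h :=
  (z.1, (⟨max z.2 (3 / 2), show (1 : ℝ) < _ from lt_max_of_lt_right (by norm_num)⟩ : rayOne))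

theorem continuous_toCyl : Continuous (toCyl h) :=
  continuous_fst.prodMk
    (Continuous.subtype_mk (continuous_snd.max continuous_const) _ :
      Continuous fun z : Y × ℝ => (⟨max z.2 (3 / 2), _⟩ : rayOne))

/-- For `3 / 2 < c.2` and `0 < w`, a neighbourhood of `c` in `Y × ℝ` whose translates by `τ ≥ 0`
have diameter at most `w` for the Riemannian distance of the cylindrical end. The condition
`3 / 2 < r` keeps it inside the cylindrical end, where these translations do not increase the
distance. -/
noncomputable def cylNhd (w : ℝ) (c : Y × ℝ) : Set (Y × ℝ) :=
  interior {z | 3 / 2 < z.2 ∧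
    riemannianEDist (𝓒 n) (toCyl h c) (toCyl h z) < ENNReal.ofReal (w / 2)}

theorem mem_cylNhd_self {w : ℝ} (hw : 0 < w) {c : Y × ℝ} (hc : 3 / 2 < c.2) : c ∈ cylNhd h w c := by
  have : IsManifold (𝓒 n) 1 (CylindricalEnd h) := .of_le (n := ∞) (by simp)
  exact mem_interior_iff_mem_nhds.2 ((continuousAt_snd.eventually (lt_mem_nhds hc)).and
    ((continuous_toCyl h).continuousAt.eventually
      (eventually_riemannianEDist_lt (𝓒 n) (toCyl h c) (by simpa using hw))))

variable {h}

theorem cylTranslate_toCyl_cylShift {τ : ℝ} (hτ : 0 ≤ τ) {p : CylindricalEnd h}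
    (hp : 3 / 2 < (cylShift τ p).2) : cylTranslate τ hτ (toCyl h (cylShift τ p)) = p := by
  have hray : rayTranslate τ hτ (toCyl h (cylShift τ p)).2 = p.2 := Subtype.ext <| by
    change max (cylCoord p - τ) (3 / 2) + τ = cylCoord p
    exact (congrArg (· + τ) (max_eq_left hp.le)).trans (sub_add_cancel _ _)
  exact congrArg (Prod.mk p.1) hray

theorem riemannianEDist_lt_of_mem_cylNhd {w τ : ℝ} (hτ : 0 ≤ τ) {c : Y × ℝ}
    {p q : CylindricalEnd h} (hp : cylShift τ p ∈ cylNhd h w c)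
    (hq : cylShift τ q ∈ cylNhd h w c) :
    riemannianEDist (𝓒 n) p q < ENNReal.ofReal w := by
  obtain ⟨hp0, hpc⟩ := interior_subset hp
  obtain ⟨hq0, hcq⟩ := interior_subset hq
  have hw : 0 < w / 2 := ENNReal.ofReal_pos.1 (pos_of_gt hpc)
  rw [riemannianEDist_comm] at hpc
  calc riemannianEDist (𝓒 n) p q
      = riemannianEDist (𝓒 n) (cylTranslate τ hτ (toCyl h (cylShift τ p)))
          (cylTranslate τ hτ (toCyl h (cylShift τ q))) := by
        rw [cylTranslate_toCyl_cylShift hτ hp0, cylTranslate_toCyl_cylShift hτ hq0]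
    _ ≤ riemannianEDist (𝓒 n) (toCyl h (cylShift τ p)) (toCyl h (cylShift τ q)) :=
        riemannianEDist_cylTranslate_le hτ _ _
    _ ≤ riemannianEDist (𝓒 n) (toCyl h (cylShift τ p)) (toCyl h c) +
          riemannianEDist (𝓒 n) (toCyl h c) (toCyl h (cylShift τ q)) := riemannianEDist_triangle
    _ < ENNReal.ofReal (w / 2) + ENNReal.ofReal (w / 2) := ENNReal.add_lt_add hpc hcq
    _ = ENNReal.ofReal w := by rw [← ENNReal.ofReal_add hw.le hw.le, add_halves]

theorem exists_mem_cylShift_mem_connectedComponentIn {R : ℝ} {S : Set (CylindricalEnd h)}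
    (hS : ∀ x, (⨅ y ∈ S, riemannianEDist (𝓒 n) x y) < ENNReal.ofReal R) (k : ℕ) {p : Y × ℝ}
    (hp : p ∈ slabCore Y R) :
    ∃ s ∈ S, cylShift (k * (4 * R)) s ∈ (univ : Set Y) ×ˢ Icc (1 + R) (1 + 3 * R) ∧
      cylShift (k * (4 * R)) s ∈ connectedComponentIn (slabCore Y R) p := by
  have hR : 0 < R := by linarith [hp.2.1, hp.2.2]
  let x : CylindricalEnd h := (p.1, (⟨1 + k * (4 * R) + 2 * R,
    show (1 : ℝ) < _ by rw [add_assoc, lt_add_iff_pos_right]; positivity⟩ : rayOne))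
  have hx : cylCoord x = 1 + k * (4 * R) + 2 * R := rfl
  have hxS := hS x
  simp only [iInf_lt_iff] at hxS
  obtain ⟨s, hs, hxs⟩ := hxS
  have hcoord := abs_lt.1 (hx ▸ abs_cylCoord_sub_lt_of_riemannianEDist_lt hxs)
  obtain ⟨Z, hZ, hxZ, hsZ⟩ := exists_isPreconnected_of_riemannianEDist_lt hxs
  have hfst : Continuous fun p : CylindricalEnd h => p.1 := continuous_fst (X := Y) (Y := rayOne)
  have hcomponent := ((hZ.image _ hfst.continuousOn).prod isPreconnected_Ioo :
    IsPreconnected (_ ×ˢ Ioo (1 + R / 2) (1 + 7 * R / 2))).subset_connectedComponentIn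
      (x := p) ⟨⟨x, hxZ, rfl⟩, hp.2⟩ (prod_mono_left (subset_univ _))
  have hs' : (cylShift (k * (4 * R)) s).2 = cylCoord s - k * (4 * R) := rfl
  refine ⟨s, hs, ⟨mem_univ _, ?_⟩, hcomponent ⟨⟨s, hsZ, rfl⟩, ?_⟩⟩ <;> rw [hs'] <;>
    constructor <;> linarith

end Network

section Construction

variable {n : ℕ} {Y : Type*} [TopologicalSpace Y] [T2Space Y] [CompactSpace Y]
  [ChartedSpace (𝔼 n) Y] [IsManifold (𝓡 n) ∞ Y]

theorem exists_contMDiff_slab_critical_subset {R : ℝ} (hR : 0 < R) :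
    ∃ f : Y × ℝ → ℝ, (∀ y r (k : ℕ), f (y, r - k * (4 * R)) = f (y, r)) ∧
      ∀ U : Set (Y × ℝ), IsOpen U →
        (∀ p ∈ slabCore Y R, (connectedComponentIn (slabCore Y R) p ∩ U).Nonempty) →
        ∃ g : Y × ℝ → ℝ, ContMDiff (𝓒 n) 𝓘(ℝ, ℝ) ∞ g ∧ EqOn g f (slabCore Y R)ᶜ ∧
          (∀ z, g z ∈ Icc 1 3) ∧
          ∀ z ∈ univ ×ˢ Icc 1 (1 + 4 * R), mfderiv (𝓒 n) 𝓘(ℝ, ℝ) g z = 0 → z ∈ U := by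
  have : LocallyConnectedSpace (ModelProd (𝔼 n) ℝ) :=
    inferInstanceAs (LocallyConnectedSpace (𝔼 n × ℝ))
  have : LocallyConnectedSpace (Y × ℝ) :=
    ChartedSpace.locallyConnectedSpace (ModelProd (𝔼 n) ℝ) (Y × ℝ)
  obtain ⟨f, hf, hf_mem, hf_periodic, F, hF, hF_sub, hcrit⟩ :=
    exists_contMDiff_periodic_finite_critical (𝓡 n) Y hR
  have hF_core : F ⊆ slabCore Y R :=
    hF_sub.trans (prod_mono_right (Icc_subset_Ioo (by linarith) (by linarith)))
  have hcore : slabCore Y R ⊆ univ ×ˢ Icc 1 (1 + 4 * R) :=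
    prod_mono_right (Ioo_subset_Icc_self.trans (Icc_subset_Icc (by linarith) (by linarith)))
  refine ⟨f, hf_periodic, fun U hU hmeet => ?_⟩
  obtain ⟨g, hg, hgf, hg_range, hg_crit⟩ := exists_contMDiff_critical_subset hf hF
    (isOpen_univ.prod isOpen_Ioo) hU hF_core hcore (fun p hp => hmeet p (hF_core hp)) hcrit
  exact ⟨g, hg, hgf, fun z => (hg_range.trans (range_subset_iff.2 hf_mem)) (mem_range_self z),
    hg_crit⟩

variable (h : ContMDiffRiemannianMetric (𝓡 n) ∞ (𝔼 n) (fun y : Y => TangentSpace (𝓡 n) y))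

theorem exists_isCbInfty_le_norm_riemGradient_of_slabs {R : ℝ} (hR : 0 < R)
    {U : ℕ → Set (Y × ℝ)} (hfin : (range U).Finite) (hU : ∀ k, IsOpen (U k))
    (hmeet : ∀ k, ∀ p ∈ slabCore Y R, (connectedComponentIn (slabCore Y R) p ∩ U k).Nonempty) :
    ∃ ψ : CylindricalEnd h → ℝ, IsCbInfty (𝓒 n) ψ ∧ (∀ p, ψ p ∈ Icc 1 3) ∧
      ∃ ρ : ℝ, 0 < ρ ∧ ∀ p,
        cylShift (slabIndex R (cylCoord p) * (4 * R)) p ∉ U (slabIndex R (cylCoord p)) →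
          ρ ≤ ‖riemGradient (𝓒 n) ψ p‖ := by
  have := hfin.to_subtype
  obtain ⟨f, hf, hperturb⟩ := exists_contMDiff_slab_critical_subset (Y := Y) (n := n) hR
  choose g hg hgf hg_mem hg_crit using fun V : range U => hperturb V.1
    (by obtain ⟨_, k, rfl⟩ := V; exact hU k) (by obtain ⟨_, k, rfl⟩ := V; exact hmeet k)
  let V (k : ℕ) : range U := ⟨U k, mem_range_self k⟩
  have hslab : IsCompact ((univ : Set Y) ×ˢ Icc 1 (1 + 4 * R)) := isCompact_univ.prod isCompact_Icc
  have htranslate := isTranslateAt_slabGlue (h := h) hR (g := fun k => g (V k)) hf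
    fun k => hgf (V k)
  have hmem (p : CylindricalEnd h) : cylShift (slabIndex R (cylCoord p) * (4 * R)) p ∈
      (univ : Set Y) ×ˢ Icc 1 (1 + 4 * R) :=
    ⟨mem_univ _, Ico_subset_Icc_self (sub_slabIndex_mem_Ico hR (one_lt_cylCoord p))⟩
  obtain ⟨ρ, hρ, hgrad⟩ := exists_pos_le_norm_riemGradient (h := h) hg
    (K := fun W => (univ ×ˢ Icc 1 (1 + 4 * R)) \ W.1)
    (fun ⟨_, k, hk⟩ => hslab.diff (hk ▸ hU k)) fun W z hz hz0 => hz.2 (hg_crit W z hz.1 hz0)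
  exact ⟨slabGlue R fun k => g (V k),
    isCbInfty_of_isTranslateAt hg hslab fun p => ⟨_, _, hmem p, htranslate p⟩,
    fun p => hg_mem _ _, ρ, hρ, fun p hp => hgrad _ p _ _ ⟨hmem p, hp⟩ (htranslate p)⟩

theorem exists_isCbInfty_le_norm_riemGradient {L w : ℝ} {S : Set (CylindricalEnd h)} (hw : 0 < w)
    (hS : ∀ x, (⨅ y ∈ S, riemannianEDist (𝓒 n) x y) ≤ ENNReal.ofReal L) :
    ∃ ψ : CylindricalEnd h → ℝ, IsCbInfty (𝓒 n) ψ ∧ (∀ p, ψ p ∈ Icc 1 3) ∧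
      ∃ ρ : ℝ, 0 < ρ ∧ ∀ p ∉ ⋃ y ∈ S, riemBall (𝓒 n) y w, ρ ≤ ‖riemGradient (𝓒 n) ψ p‖ := by
  let R := |L| + 1
  have hR : 1 ≤ R := le_add_of_nonneg_left (abs_nonneg L)
  have hS' (x : CylindricalEnd h) :
      (⨅ y ∈ S, riemannianEDist (𝓒 n) x y) < ENNReal.ofReal R :=
    (hS x).trans_lt ((ENNReal.ofReal_lt_ofReal_iff (by positivity)).2
      ((le_abs_self L).trans_lt (lt_add_one _)))
  obtain ⟨C, -, hC⟩ := (isCompact_univ.prod isCompact_Icc :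
      IsCompact ((univ : Set Y) ×ˢ Icc (1 + R) (1 + 3 * R))).elim_nhds_subcover (cylNhd h w)
    fun c hc => isOpen_interior.mem_nhds (mem_cylNhd_self h hw (by linarith [hc.2.1]))
  let A (k : ℕ) : Set C := {c | ∃ s ∈ S, cylShift (k * (4 * R)) s ∈ cylNhd h w c}
  let V (D : Set C) : Set (Y × ℝ) := ⋃ c ∈ D, cylNhd h w c
  obtain ⟨ψ, hψ, hψ_mem, ρ, hρ, hgrad⟩ :=
    exists_isCbInfty_le_norm_riemGradient_of_slabs h (one_pos.trans_le hR) (U := V ∘ A)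
      ((finite_range V).subset (range_comp_subset_range A V))
      (fun k => isOpen_biUnion fun c _ => isOpen_interior) fun k p hp => by
        obtain ⟨s, hs, hsR, hsp⟩ := exists_mem_cylShift_mem_connectedComponentIn hS' k hp
        obtain ⟨c, hc, hsc⟩ := mem_iUnion₂.1 (hC hsR)
        exact ⟨_, hsp, mem_iUnion₂.2 ⟨⟨c, hc⟩, ⟨s, hs, hsc⟩, hsc⟩⟩
  refine ⟨ψ, hψ, hψ_mem, ρ, hρ, fun p hp => hgrad p fun hpV => hp ?_⟩
  obtain ⟨c, ⟨s, hs, hsc⟩, hpc⟩ := mem_iUnion₂.1 hpV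
  exact mem_iUnion₂.2 ⟨s, hs, riemannianEDist_lt_of_mem_cylNhd (by positivity) hsc hpc⟩

end Construction

theorem lemma3p1 {n : ℕ} {Y : Type*} [TopologicalSpace Y] [T2Space Y] [CompactSpace Y]
    [ChartedSpace (EuclideanSpace ℝ (Fin n)) Y] [IsManifold (𝓡 n) ∞ Y]
    (h : ContMDiffRiemannianMetric (𝓡 n) ∞ (EuclideanSpace ℝ (Fin n))
      (fun y : Y => TangentSpace (𝓡 n) y))
    (a : CylindricalEnd h → ℝ) (L w β : ℝ) (S : Set (CylindricalEnd h))
    (hNCC : NetworkControl ((𝓡 n).prod 𝓘(ℝ, ℝ)) a L w (2 * β) S) :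
    ∃ ψ : CylindricalEnd h → ℝ,
      IsCbInfty ((𝓡 n).prod 𝓘(ℝ, ℝ)) ψ ∧
      (∀ x, 1 ≤ ψ x ∧ ψ x ≤ 3) ∧
      ∃ ρ : ℝ, 0 < ρ ∧
        (∀ x, a x < 2 * β → 2 * ρ ≤ ‖riemGradient ((𝓡 n).prod 𝓘(ℝ, ℝ)) ψ x‖) ∧
        ((⋃ y ∈ S, riemBall ((𝓡 n).prod 𝓘(ℝ, ℝ)) y w) ⊆ superlevel a (2 * β) →
          ∀ x, x ∉ superlevel a (2 * β) →
            2 * ρ ≤ ‖riemGradient ((𝓡 n).prod 𝓘(ℝ, ℝ)) ψ x‖) := by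
  obtain ⟨ψ, hψ, hψ_mem, ρ, hρ, hgrad⟩ :=
    exists_isCbInfty_le_norm_riemGradient h hNCC.w_pos hNCC.dist_le
  refine ⟨ψ, hψ, hψ_mem, ρ / 2, half_pos hρ, ?_⟩
  rw [mul_div_cancel₀ ρ two_ne_zero]
  exact ⟨fun x hx => hgrad x fun hball => hx.not_ge (hNCC.le_on_balls x hball),
    fun hsub x hx => hgrad x fun hball => hx (hsub hball)⟩
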